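/- Let $k$ be a field, let $n\ge 2$ be an even integer, let $v=\sum_{i=1}^n v_i x_i$ with $v_i\in k$ be a linear combination of the variables and let $\lambda\in k$. Let $$U=k\langle x_1,\dots,x_n\rangle\Big/\Big(\sum_{1\le i\le n/2}[x_i,x_{i+n/2}]-v-\lambda\Big),\qquad [a,b]=ab-ba,$$ filtered by the images $U_m$ of the spaces $F^m=\bigoplus_{j\le m}V^{\otimes j}$, where $V=\bigoplus_{i=1}^n kx_i$ and $k\langle x_1,\dots,x_n\rangle=T(V)$. Write $U=T(V)/I(P)$, where $P$ is the line spanned by the relation. Then: 1. The filtered algebra $U$ is Koszul, i.e. there is $N\ge 2$ such that $P\subseteq F^N$ and, with $R\subseteq V^{\otimes N}$ the image of $P$ under the projection $F^N\to V^{\otimes N}$, the algebra $A=T(V)/I(R)$ is $N$-Koszul and $U$ is a PBW deformation of $A$. Here $A$ is $N$-Koszul if its Koszul complex $(A\otimes W_{\nu_N(i)})_{i\ge 0}$ has zero homology in all degrees $i>0$, where $\nu_N(2i)=Ni$, $\nu_N(2i+1)=Ni+1$, $W_m=\bigcap_{i+N+j=m}V^{\otimes i}\otimes R\otimes V^{\otimes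 j}$ (so $W_m=V^{\otimes m}$ for $m<N$), and the left $A$-linear differential is induced by the inclusion $W_{\nu_N(i)}\subseteq V^{\otimes(\nu_N(i)-\nu_N(i-1))}\otimes W_{\nu_N(i-1)}$; and $U$ is a PBW deformation of $A$ if $P=(\mathrm{Id}-\varphi)(R)$ for some linear map $\varphi:R\to F^{N-1}$ and the natural graded algebra morphism $A\to\mathrm{gr}(U)$ is an isomorphism. 2. $\mathrm{HH}^i(U,U\otimes U)=\mathrm{Ext}^i_{U^e}(U,U\otimes U)=0$ for all $i\ne 2$, where $U^e=U\otimes U^{op}$ and $U\otimes U$ carries the outer bimodule structure. 3. $U$ is $2$-Calabi–Yau if and only if $v=0$. Here an algebra $B$ is called $d$-Calabi–Yau ($d\ge 1$) if it has a projective $B$-bimodule resolution of finite length by finitely generated bimodules, $\mathrm{Ext}^i_{B^e}(B,B^e)=0$ for $i\neq d$, and $\mathrm{Ext}^d_{B^e}(B,B^e)\cong B$ as right $B^e$-modules. -/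

import Mathlib

open scoped TensorProduct

universe u

namespace KoszulPBW

noncomputable section

section Quotients

variable {k : Type u} [Field k] {V : Type u} [AddCommGroup V] [Module k V]

/-- The homogeneous component `V^{⊗ m}` of the tensor algebra `T(V)`, as a subspace of `T(V)`. -/
abbrev tpow (k : Type u) [Field k] (V : Type u) [AddCommGroup V] [Module k V] (m : ℕ) :
    Submodule k (TensorAlgebra k V) :=
  LinearMap.range (TensorAlgebra.ι k : V →ₗ[k] TensorAlgebra k V) ^ m

/-- The filtration `F^m = k ⊕ V ⊕ ⋯ ⊕ V^{⊗ m}` of `T(V)`. -/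
def tfilt (k : Type u) [Field k] (V : Type u) [AddCommGroup V] [Module k V] (m : ℕ) :
    Submodule k (TensorAlgebra k V) :=
  ⨆ (i : ℕ) (_ : i ≤ m), tpow k V i

/-- The projection of `T(V)` onto its component `V^{⊗ m}`, as an endomorphism of `T(V)`. -/
def tproj (k : Type u) [Field k] (V : Type u) [AddCommGroup V] [Module k V] (m : ℕ) :
    TensorAlgebra k V →ₗ[k] TensorAlgebra k V :=
  GradedAlgebra.proj (fun i : ℕ => tpow k V i) m

theorem tpow_le_tfilt (m : ℕ) : tpow k V m ≤ tfilt k V m :=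
  le_iSup₂_of_le (f := fun (i : ℕ) (_ : i ≤ m) => tpow k V i) m le_rfl le_rfl

/-- `T(V)/I(P)`, where `I(P)` is the two-sided ideal generated by the subspace `P`. -/
abbrev QuotAlg (P : Submodule k (TensorAlgebra k V)) : Type u :=
  TensorAlgebra k V ⧸ (TwoSidedIdeal.span (P : Set (TensorAlgebra k V))).asIdeal

/-- The quotient map `T(V) → T(V)/I(P)`. -/
abbrev qmk (P : Submodule k (TensorAlgebra k V)) : TensorAlgebra k V →ₐ[k] QuotAlg P :=
  Ideal.Quotient.mkₐ k _

/-! ### Koszulity of `N`-homogeneous algebras -/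

/-- The function `ν_N`; it is defined by its increments so that the tensor powers occurring in the
Koszul complex match definitionally. See `nu_even` and `nu_odd` for the closed formulas. -/
def nuStep (N i : ℕ) : ℕ := if Even i then 1 else N - 1

/-- The function `ν_N`, with `ν_N (2 i) = N i` and `ν_N (2 i + 1) = N i + 1`. -/
def nu (N : ℕ) : ℕ → ℕ
  | 0 => 0
  | i + 1 => nuStep N i + nu N i

theorem nu_even (N : ℕ) (hN : 1 ≤ N) (i : ℕ) : nu N (2 * i) = N * i := by
  induction i with
  | zero => simp [nu]
  | succ i ih =>
    have h : 2 * (i + 1) = (2 * i + 1) + 1 := by ring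
    have ho : ¬ Even (2 * i + 1) := by simp
    have he : Even (2 * i) := by simp
    rw [h, nu, nu, ih, nuStep, nuStep, if_neg ho, if_pos he, Nat.mul_add]
    omega

theorem nu_odd (N : ℕ) (hN : 1 ≤ N) (i : ℕ) : nu N (2 * i + 1) = N * i + 1 := by
  have he : Even (2 * i) := by simp
  rw [nu, nu_even N hN, nuStep, if_pos he, add_comm]

/-- `W_m = ⋂_{i+N+j=m} V^{⊗ i} ⊗ R ⊗ V^{⊗ j}`, a subspace of `V^{⊗ m}`, for `R ⊆ V^{⊗ N}`. -/
def W (N : ℕ) (R : Submodule k (TensorAlgebra k V)) (m : ℕ) : Submodule k (⨂[k]^m V) :=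
  ⨅ (i : ℕ) (j : ℕ) (_ : i + N + j = m),
    (tpow k V i * R * tpow k V j).comap TensorPower.toTensorAlgebra

/-- The map `A ⊗ V^{⊗ (s + m)} → A ⊗ V^{⊗ m}`, `a ⊗ (t ⊗ w) ↦ a t ⊗ w`, where `A = T(V)/I(R)`. -/
def splitMul (R : Submodule k (TensorAlgebra k V)) (s m : ℕ) :
    QuotAlg R ⊗[k] (⨂[k]^(s + m) V) →ₗ[k] QuotAlg R ⊗[k] (⨂[k]^m V) :=
  LinearMap.rTensor (⨂[k]^m V)
      (LinearMap.mul' k (QuotAlg R) ∘ₗ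
        LinearMap.lTensor (QuotAlg R) ((qmk R).toLinearMap ∘ₗ TensorPower.toTensorAlgebra)) ∘ₗ
    (TensorProduct.assoc k (QuotAlg R) (⨂[k]^s V) (⨂[k]^m V)).symm.toLinearMap ∘ₗ
    LinearMap.lTensor (QuotAlg R) TensorPower.mulEquiv.symm.toLinearMap

theorem splitMul_tmul (R : Submodule k (TensorAlgebra k V)) (s m : ℕ) (a : QuotAlg R)
    (t : ⨂[k]^s V) (w : ⨂[k]^m V) :
    splitMul R s m (a ⊗ₜ TensorPower.mulEquiv (t ⊗ₜ w)) =
      (a * qmk R (TensorPower.toTensorAlgebra t)) ⊗ₜ w := by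
  simp [splitMul]

/-- The `i`-th term `K_i = A ⊗ W_{ν_N(i)}` of the Koszul complex of `A = T(V)/I(R)`, as a subspace
of `A ⊗ V^{⊗ ν_N(i)}` (tensor products over a field preserve injections). -/
def K (N : ℕ) (R : Submodule k (TensorAlgebra k V)) (i : ℕ) :
    Submodule k (QuotAlg R ⊗[k] (⨂[k]^(nu N i) V)) :=
  LinearMap.range (LinearMap.lTensor (QuotAlg R) (W N R (nu N i)).subtype)

/-- The Koszul differential `δ_{i+1}`, which maps `K_{i+1}` to `K_i`, on the ambient spaces. -/
def delta (N : ℕ) (R : Submodule k (TensorAlgebra k V)) (i : ℕ) :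
    QuotAlg R ⊗[k] (⨂[k]^(nu N (i + 1)) V) →ₗ[k] QuotAlg R ⊗[k] (⨂[k]^(nu N i) V) :=
  splitMul R (nuStep N i) (nu N i)

/-- `A = T(V)/I(R)`, with `R ⊆ V^{⊗ N}`, is `N`-Koszul: the homology of the Koszul complex vanishes
in every positive degree, i.e. cycles and boundaries agree in each degree `i + 1`. -/
def IsNKoszul (N : ℕ) (R : Submodule k (TensorAlgebra k V)) : Prop :=
  2 ≤ N ∧ R ≤ tpow k V N ∧
    ∀ i : ℕ, K N R (i + 1) ⊓ LinearMap.ker (delta N R i) =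
      (K N R (i + 2)).map (delta N R (i + 1))

/-! ### PBW deformations -/

/-- The filtration of `U = T(V)/I(P)` induced by the filtration of `T(V)`. -/
def ufilt (P : Submodule k (TensorAlgebra k V)) (m : ℕ) : Submodule k (QuotAlg P) :=
  (tfilt k V m).map (qmk P).toLinearMap

/-- The step `U_{m-1}` of the filtration, with `U_{-1} = 0`. -/
def ufiltPred (P : Submodule k (TensorAlgebra k V)) : ℕ → Submodule k (QuotAlg P)
  | 0 => ⊥
  | m + 1 => ufilt P m

/-- The component `gr_m(U) = U_m / U_{m-1}` of the associated graded algebra of `U`. -/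
abbrev Gr (P : Submodule k (TensorAlgebra k V)) (m : ℕ) : Type u :=
  ↥(ufilt P m) ⧸ (ufiltPred P m).submoduleOf (ufilt P m)

/-- The map `V^{⊗ m} → gr_m(U)`. -/
def toGr (P : Submodule k (TensorAlgebra k V)) (m : ℕ) : ↥(tpow k V m) →ₗ[k] Gr P m :=
  Submodule.mkQ _ ∘ₗ
    (qmk P).toLinearMap.restrict (p := tpow k V m) (q := ufilt P m)
      (fun _ ht => Submodule.mem_map_of_mem (tpow_le_tfilt m ht))

/-- The component `A_m` of the graded algebra `A = T(V)/I(R)`, where `R` is homogeneous. -/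
def acomp (R : Submodule k (TensorAlgebra k V)) (m : ℕ) : Submodule k (QuotAlg R) :=
  (tpow k V m).map (qmk R).toLinearMap

/-- The map `V^{⊗ m} → A_m`. -/
def toAcomp (R : Submodule k (TensorAlgebra k V)) (m : ℕ) : ↥(tpow k V m) →ₗ[k] ↥(acomp R m) :=
  (qmk R).toLinearMap.restrict (p := tpow k V m) (q := acomp R m)
    (fun _ ht => Submodule.mem_map_of_mem ht)

/-- For `R ⊆ V^{⊗ N}`: `P = (Id - φ)(R)` for a linear map `φ : R → F^{N-1}`, and the natural
morphism from `A = T(V)/I(R)` to the associated graded algebra of `U = T(V)/I(P)` is an isomorphism.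
In degree `m` this morphism sends the class in `A_m` of `t ∈ V^{⊗ m}` to its class in `gr_m(U)`;
this determines it, since `V^{⊗ m} → A_m` is onto, and makes it multiplicative. -/
def IsPBWDeformation (N : ℕ) (R P : Submodule k (TensorAlgebra k V)) : Prop :=
  R ≤ tpow k V N ∧
  (∃ φ : ↥R →ₗ[k] TensorAlgebra k V,
    (∀ r, φ r ∈ tfilt k V (N - 1)) ∧ P = LinearMap.range (R.subtype - φ)) ∧
  ∃ p : ∀ m : ℕ, ↥(acomp R m) ≃ₗ[k] Gr P m,
    ∀ (m : ℕ) (t : ↥(tpow k V m)), p m (toAcomp R m t) = toGr P m t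

/-- The filtered algebra `U = T(V)/I(P)` is Koszul: for some `N ≥ 2` one has `P ⊆ F^N`, and `U` is a
PBW deformation of the `N`-Koszul algebra `T(V)/I(R)`, where `R ⊆ V^{⊗ N}` is the image of `P`
under the projection `F^N → V^{⊗ N}`. -/
def IsKoszulFiltered (P : Submodule k (TensorAlgebra k V)) : Prop :=
  ∃ N : ℕ, 2 ≤ N ∧ P ≤ tfilt k V N ∧
    IsNKoszul N (P.map (tproj k V N)) ∧ IsPBWDeformation N (P.map (tproj k V N)) P

end Quotients

/-! ### Hochschild cohomology and Calabi-Yau algebras -/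

section CalabiYau

open CategoryTheory CategoryTheory.Abelian MulOpposite

variable (k : Type u) [Field k] (A : Type u) [Ring A] [Algebra k A]

/-- The enveloping algebra `A^e = A ⊗ A^op`. Left `A^e`-modules are `A`-bimodules (on which `k`
acts centrally): `(a ⊗ b) m = a m b`. -/
abbrev Env : Type u := A ⊗[k] Aᵐᵒᵖ

/-- `A` as an `A`-bimodule. -/
def selfBimod : ModuleCat.{u} (Env k A) :=
  letI : Module (Env k A) A := instModuleTensorProductMop k A
  ModuleCat.of (Env k A) A

theorem selfBimod_smul (a x : A) (b : Aᵐᵒᵖ) :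
    ((a ⊗ₜ[k] b : Env k A) • (show selfBimod k A from x) : selfBimod k A) =
      (show selfBimod k A from a * x * unop b) := by
  let : Module (Env k A) A := instModuleTensorProductMop k A
  change (a ⊗ₜ[k] b : Env k A) • x = a * x * unop b
  simp [TensorProduct.Algebra.smul_def, MulOpposite.smul_eq_mul_unop, mul_assoc]

/-- `A ⊗ A` as an `A`-bimodule for the outer structure, i.e. `A^e` as a left `A^e`-module. -/
def outerBimod : ModuleCat.{u} (Env k A) := ModuleCat.of (Env k A) (Env k A)

/-- Hochschild cohomology `HH^i(A, M) = Ext^i_{A^e}(A, M)`. -/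
abbrev HH (M : ModuleCat.{u} (Env k A)) (i : ℕ) : Type u := Ext (selfBimod k A) M i

variable {A}

/-- Right multiplication by `r` on `A^e`, a morphism of left `A^e`-modules. -/
def rightMul (r : Env k A) : outerBimod k A ⟶ outerBimod k A :=
  ModuleCat.ofHom (LinearMap.toSpanSingleton (Env k A) (Env k A) r)

/-- The right action of `A^e` on `Ext^i_{A^e}(A, A^e)`, induced by right multiplication on the
coefficients `A^e`. -/
def extRightAct {i : ℕ} (ξ : HH k A (outerBimod k A) i) (r : Env k A) :
    HH k A (outerBimod k A) i :=
  ξ.comp (Ext.mk₀ (rightMul k r)) (add_zero i)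

/-- The right action of `A^e` on `A`: `x (a ⊗ b) = b x a`. -/
def selfRightAct (x : A) (r : Env k A) : A :=
  AlgHom.mulLeftRight k A
    (TensorProduct.map (opLinearEquiv k : A ≃ₗ[k] Aᵐᵒᵖ).symm.toLinearMap
      (opLinearEquiv k : A ≃ₗ[k] Aᵐᵒᵖ).toLinearMap (TensorProduct.comm k A Aᵐᵒᵖ r)) x

theorem selfRightAct_tmul (x a : A) (b : Aᵐᵒᵖ) :
    selfRightAct k x (a ⊗ₜ b) = unop b * x * a := by
  simp [selfRightAct]

variable (A)

/-- `A` has a finite projective bimodule resolution by bimodules of finite type. -/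
def HasFiniteBimodResolution : Prop :=
  ∃ Q : ProjectiveResolution (selfBimod k A),
    (∀ i, Module.Finite (Env k A) (Q.complex.X i)) ∧
      ∃ m : ℕ, ∀ i, m < i → Limits.IsZero (Q.complex.X i)

/-- `A` is a `d`-Calabi-Yau algebra: it has a finite projective bimodule resolution by bimodules of
finite type, `Ext^i_{A^e}(A, A^e) = 0` for `i ≠ d`, and `Ext^d_{A^e}(A, A^e) ≅ A` as right
`A^e`-modules. -/
def IsCalabiYau (d : ℕ) : Prop :=
  1 ≤ d ∧ HasFiniteBimodResolution k A ∧
  (∀ i : ℕ, i ≠ d → Subsingleton (Ext (selfBimod k A) (outerBimod k A) i)) ∧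
  ∃ e : Ext (selfBimod k A) (outerBimod k A) d ≃+ A,
    ∀ ξ r, e (extRightAct k ξ r) = selfRightAct k (e ξ) r

end CalabiYau

/-! ### The algebras of the theorem -/

section Symplectic

variable {k : Type u} [Field k]

/-- The generator `x_i` of the free algebra `T(k^n) = k⟨x_1, …, x_n⟩`, with indices from `0`. -/
def gen (k : Type u) [Field k] {n : ℕ} (i : Fin n) : TensorAlgebra k (Fin n → k) :=
  TensorAlgebra.ι k (Pi.single i 1)

/-- `∑_{i ≤ n/2} [x_i, x_{i + n/2}]`. -/
def symplecticForm (k : Type u) [Field k] (n : ℕ) : TensorAlgebra k (Fin n → k) :=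
  ∑ i : Fin (n / 2), ⁅gen k (⟨i, by omega⟩ : Fin n), gen k (⟨i + n / 2, by omega⟩ : Fin n)⁆

/-- The line spanned by `∑_{i ≤ n/2} [x_i, x_{i + n/2}] - v - λ`, where the vector
`v = (v_1, …, v_n)` stands for the linear form `∑ v_i x_i`. -/
def relSpace (n : ℕ) (v : Fin n → k) (l : k) : Submodule k (TensorAlgebra k (Fin n → k)) :=
  Submodule.span k {symplecticForm k n - TensorAlgebra.ι k v - algebraMap k _ l}

end Symplectic

end

end KoszulPBW

/-! The relation rewrites x_b x_{b*}, for one conjugate pair b, b*, through other words, and this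
word does not overlap itself. So right multiplication by the generators can be modelled by explicit
operators on T(V) (`normalMul`, `normalOp`) that satisfy the relation, and the orbit of 1 is a
linear section `Presents.normalForm` of T(V) → U. The terms v and λ alter these operators only in
lower degree; comparing the normal forms in U and in A gives the PBW property
(`Presents.freeLift_eq_zero_iff`).

Put d_j = x_j ⊗ 1 - 1 ⊗ x_j and c_j = -sgn_j d_{j*} - v_j (`symCoeff`). The homological part rests
on the exact sequence 0 → U^e → (U^e)^n → U^e → U → 0 with coefficients c and d
(`Presents.isExactSeq`). Exactness at (U^e)^n comes from a derivation with prescribed values on the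
generators, which the presentation provides; injectivity on the left comes from normal forms and the
local nilpotence of "delete the last letter". Derivations and normal forms also make the Koszul
complex of A exact (`koszulComplex_exact`), which is short because W_m = 0 for m ≥ 3 (`W_eq_bot`).

The dual complex needs no new computation: swapping the factors of U^e and then translating the
generators is an anti-automorphism that exchanges d and c up to signs (`Presents.exists_duality`).
Hence Ext^0 and Ext^1 vanish, and Ext^2 = U^e / ∑ c_j U^e.

If v = 0, then c_j = ±d_{j*} and this quotient is U. If v ≠ 0, then U has a character χ. An
isomorphism Ext^2 ≅ U would send the class of 1 to some u generating U, so χ(u) ≠ 0; but u c_j = 0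
says that v_j u is a multiple of a commutator, so v_j χ(u) = 0 for all j, a contradiction. -/

namespace KoszulPBW

/-! ### Presentations by a symplectic relation, and derivations from triangular matrices -/

section Presentation

variable {k : Type u} [Field k] {n : ℕ}

/-- A pairing of the indices `j ↔ star j`, with signs, describing the symplectic relation
`∑ j, sgn j • x_j x_{star j}`. -/
structure Darboux (k : Type u) [Field k] (n : ℕ) where
  star : Fin n → Fin n
  sgn : Fin n → k
  base : Fin n
  star_star : ∀ j, star (star j) = j
  sgn_star : ∀ j, sgn (star j) = - sgn j
  sgn_mul_self : ∀ j, sgn j * sgn j = 1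
  sgn_base : sgn base = 1
  star_ne : ∀ j, star j ≠ j

/-- The permutation `j ↦ star j`. -/
def Darboux.perm (D : Darboux k n) : Equiv.Perm (Fin n) :=
  ⟨D.star, D.star, D.star_star, D.star_star⟩

theorem Darboux.sum_star {M : Type*} [AddCommMonoid M] (D : Darboux k n) (f : Fin n → M) :
    ∑ j, f (D.star j) = ∑ j, f j :=
  Equiv.sum_comp D.perm f

theorem Darboux.sum_eq_zero {M : Type*} [AddCommGroup M] (D : Darboux k n) (f : Fin n → M)
    (h : ∀ j, f j + f (D.star j) = 0) : ∑ j, f j = 0 :=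
  Finset.sum_involution (fun j _ => D.star j) (fun j _ => h j) (fun j _ _ => D.star_ne j)
    (fun _ _ => Finset.mem_univ _) fun j _ => D.star_star j

theorem Darboux.star_ne_star_base (D : Darboux k n) {j : Fin n} (h : j ≠ D.base) :
    D.star j ≠ D.star D.base := fun e => h (by rw [← D.star_star j, e, D.star_star])

/-- The elements `x_j` satisfy the symplectic relation with linear part `v` and constant `l`. -/
def SatisfiesRel (D : Darboux k n) (v : Fin n → k) (l : k) {U : Type*} [Ring U] [Algebra k U]
    (x : Fin n → U) : Prop :=
  ∑ j, D.sgn j • (x j * x (D.star j)) = ∑ j, v j • x j + algebraMap k U l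

/-- The algebra `U` is presented by the generators `x_j` and the symplectic relation. -/
structure Presents (D : Darboux k n) (v : Fin n → k) (l : k) {U : Type u} [Ring U] [Algebra k U]
    (x : Fin n → U) : Prop where
  rel : SatisfiesRel D v l x
  adjoin_eq_top : Algebra.adjoin k (Set.range x) = ⊤
  lift : ∀ (B : Type u) [Ring B] [Algebra k B] (y : Fin n → B), SatisfiesRel D v l y →
    ∃ f : U →ₐ[k] B, ∀ j, f (x j) = y j

/-- The elements b with S b ⊆ S form a subalgebra containing the generators. This is the induction
principle for linear maps that are known only through their behaviour under right multiplication by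
one generator. -/
theorem eq_top_of_mul_right_mem {U : Type*} [Ring U] [Algebra k U] {x : Fin n → U}
    (gen : Algebra.adjoin k (Set.range x) = ⊤) (S : Submodule k U) (h1 : (1 : U) ∈ S)
    (hS : ∀ a ∈ S, ∀ j, a * x j ∈ S) (a : U) : a ∈ S := by
  have key : ∀ b : U, ∀ a ∈ S, a * b ∈ S := by
    intro b
    have hb : b ∈ Algebra.adjoin k (Set.range x) := gen ▸ Algebra.mem_top
    induction hb using Algebra.adjoin_induction with
    | mem y hy => obtain ⟨j, rfl⟩ := hy; exact fun a ha => hS a ha j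
    | algebraMap r =>
      intro a ha
      rw [← Algebra.commutes, ← Algebra.smul_def]
      exact S.smul_mem r ha
    | add y z _ _ hy hz => exact fun a ha => by rw [mul_add]; exact S.add_mem (hy a ha) (hz a ha)
    | mul y z _ _ hy hz => exact fun a ha => by rw [← mul_assoc]; exact hz _ (hy a ha)
  simpa using key a 1 h1

/-- The matrix operator `(m, s) ↦ (f m + e s, g s)`. -/
def upperTriangular {M S : Type*} [AddCommGroup M] [Module k M] [AddCommGroup S] [Module k S]
    (f : Module.End k M) (e : S →ₗ[k] M) (g : Module.End k S) : Module.End k (M × S) :=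
  LinearMap.prod (f ∘ₗ LinearMap.fst k M S + e ∘ₗ LinearMap.snd k M S) (g ∘ₗ LinearMap.snd k M S)

theorem upperTriangular_apply {M S : Type*} [AddCommGroup M] [Module k M] [AddCommGroup S]
    [Module k S] (f : Module.End k M) (e : S →ₗ[k] M) (g : Module.End k S) (m : M) (s : S) :
    upperTriangular f e g (m, s) = (f m + e s, g s) := rfl

/-- A representation by upper triangular matrices gives a derivation in its off-diagonal entry. -/
theorem exists_derivation {U : Type*} [Ring U] [Algebra k U] {x : Fin n → U}
    (gen : Algebra.adjoin k (Set.range x) = ⊤)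
    {M S : Type*} [AddCommGroup M] [Module k M] [AddCommGroup S] [Module k S]
    (f : U →ₐ[k] Module.End k M) (g : U →ₐ[k] Module.End k S) (e : Fin n → S →ₗ[k] M)
    (F : U →ₐ[k] Module.End k (M × S))
    (hF : ∀ j, F (x j) = upperTriangular (f (x j)) (e j) (g (x j))) :
    ∃ Δ : U →ₗ[k] S →ₗ[k] M, Δ 1 = 0 ∧ (∀ j, Δ (x j) = e j) ∧
      ∀ a b s, Δ (a * b) s = f a (Δ b s) + Δ a (g b s) := by
  -- Triangularity passes from the generators to all of U; the upper right entry a ↦ (F a (0, s)).1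
  -- is then the derivation, and its Leibniz rule is matrix multiplication.
  have key : ∀ (a : U) (m : M) (s : S), F a (m, s) = (f a m + (F a (0, s)).1, g a s) := by
    intro a
    have ha : a ∈ Algebra.adjoin k (Set.range x) := gen ▸ Algebra.mem_top
    induction ha using Algebra.adjoin_induction with
    | mem y hy => obtain ⟨j, rfl⟩ := hy; intro m s; simp [hF, upperTriangular]
    | algebraMap r => intro m s; simp [Module.algebraMap_end_apply]
    | add y z _ _ hy hz =>
      intro m s
      simp only [map_add, LinearMap.add_apply]
      rw [hy m s, hz m s]
      ext
      · simp only [Prod.fst_add]; abel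
      · simp
    | mul y z _ _ hy hz =>
      intro m s
      simp only [map_mul, Module.End.mul_apply]
      rw [hz m s, hz 0 s, hy, hy (f z 0 + _)]
      ext
      · simp [add_assoc]
      · simp
  refine ⟨LinearMap.mk₂ k (fun a s => (F a (0, s)).1) ?_ ?_ ?_ ?_, ?_, ?_, ?_⟩
  · intro a b s; simp
  · intro c a s; simp
  · intro a s t
    have : ((0 : M), s + t) = (0, s) + (0, t) := by simp
    rw [this, map_add, Prod.fst_add]
  · intro c a s
    have : ((0 : M), c • s) = c • ((0 : M), s) := by simp
    rw [this, map_smul, Prod.smul_fst]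
  · ext s; simp
  · intro j; ext s; simp [hF, upperTriangular]
  · intro a b s
    simp only [LinearMap.mk₂_apply, map_mul, Module.End.mul_apply]
    rw [key b 0 s, key a]

end Presentation

/-! ### Right derivatives and filtration of the free algebra -/

section TensorAlgebra

variable {k : Type u} [Field k] {n : ℕ}

theorem ι_eq_sum (w : Fin n → k) : TensorAlgebra.ι k w = ∑ j, w j • gen k j := by
  conv_lhs => rw [pi_eq_sum_univ w]
  simp only [map_sum, map_smul, gen]
  refine Finset.sum_congr rfl fun j _ => ?_
  congr 2
  ext i
  simp [Pi.single_apply, eq_comm]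

theorem adjoin_gen : Algebra.adjoin k (Set.range (gen k (n := n))) = ⊤ := by
  rw [eq_top_iff, ← TensorAlgebra.adjoin_range_ι]
  refine Algebra.adjoin_le ?_
  rintro _ ⟨w, rfl⟩
  rw [ι_eq_sum]
  exact Subalgebra.sum_mem _ fun j _ =>
    Subalgebra.smul_mem _ (Algebra.subset_adjoin (Set.mem_range_self j)) _

/-- Algebra maps out of the free algebra with prescribed values on the generators. -/
def freeLift {B : Type*} [Ring B] [Algebra k B] (y : Fin n → B) :
    TensorAlgebra k (Fin n → k) →ₐ[k] B :=
  TensorAlgebra.lift k (Fintype.linearCombination k y)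

@[simp] theorem freeLift_gen {B : Type*} [Ring B] [Algebra k B] (y : Fin n → B) (j : Fin n) :
    freeLift y (gen k j) = y j := by
  simp [freeLift, gen]

/-- A derivation with Δ(a b) = a Δ(b) + Δ(a) ε(b), where ε is the augmentation killing all
generators, satisfies Δ(t x_i) = t Δ(x_i). Taking Δ(x_i) to be the i-th basis vector, the
coordinates of Δ delete a last letter. -/
theorem exists_rightDeriv :
    ∃ d : Fin n → TensorAlgebra k (Fin n → k) →ₗ[k] TensorAlgebra k (Fin n → k),
      (∀ j, d j 1 = 0) ∧ ∀ i j t, d j (t * gen k i) = if i = j then t else 0 := by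
  obtain ⟨Δ, h1, hx, hm⟩ := exists_derivation (adjoin_gen (k := k) (n := n))
    (M := Fin n → TensorAlgebra k (Fin n → k)) (S := k)
    (Algebra.lsmul k k (Fin n → TensorAlgebra k (Fin n → k)))
    ((Algebra.lsmul k k k).comp (freeLift (fun _ => (0 : k))))
    (fun j => LinearMap.toSpanSingleton k _ (Pi.single j 1))
    (freeLift fun j => upperTriangular (Algebra.lsmul k k _ (gen k j))
      (LinearMap.toSpanSingleton k _ (Pi.single j 1))
      ((Algebra.lsmul k k k).comp (freeLift (fun _ => (0 : k))) (gen k j))) (by simp)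
  refine ⟨fun j => LinearMap.proj j ∘ₗ (LinearMap.applyₗ (1 : k)) ∘ₗ Δ, ?_, ?_⟩
  · intro j; simp [h1]
  · intro i j t
    simp [hm, hx, Pi.single_apply, eq_comm]

/-- The right derivatives of the free algebra: `rightDeriv j (t x_i)` is `t` if `i = j`, else `0`. -/
noncomputable def rightDeriv (j : Fin n) :
    TensorAlgebra k (Fin n → k) →ₗ[k] TensorAlgebra k (Fin n → k) :=
  exists_rightDeriv.choose j

theorem rightDeriv_one (j : Fin n) : rightDeriv (k := k) j 1 = 0 :=
  exists_rightDeriv.choose_spec.1 j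

theorem rightDeriv_mul_gen (i j : Fin n) (t : TensorAlgebra k (Fin n → k)) :
    rightDeriv j (t * gen k i) = if i = j then t else 0 :=
  exists_rightDeriv.choose_spec.2 i j t

/-- Each application deletes the last letter of a word or kills the word. This is what ends the
iteration in `Presents.eq_zero_of_mul_symCoeff`. -/
theorem rightDeriv_locally_nilpotent (j : Fin n) (t : TensorAlgebra k (Fin n → k)) :
    ∃ m, (rightDeriv j ^ m) t = 0 := by
  let S : Submodule k (TensorAlgebra k (Fin n → k)) :=
    { carrier := {t | ∃ m, (rightDeriv j ^ m) t = 0}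
      zero_mem' := ⟨0, by simp⟩
      add_mem' := by
        rintro a b ⟨p, hp⟩ ⟨q, hq⟩
        refine ⟨p + q, ?_⟩
        rw [map_add, pow_add, Module.End.mul_apply, Module.End.mul_apply, hq, map_zero, add_zero,
          ← Module.End.mul_apply, ← pow_add, add_comm, pow_add, Module.End.mul_apply, hp, map_zero]
      smul_mem' := by
        rintro c a ⟨p, hp⟩
        exact ⟨p, by rw [map_smul, hp, smul_zero]⟩ }
  refine eq_top_of_mul_right_mem adjoin_gen S ⟨1, by simp [rightDeriv_one]⟩ ?_ t
  rintro a ⟨m, hm⟩ i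
  refine ⟨m + 1, ?_⟩
  rw [pow_succ, Module.End.mul_apply, rightDeriv_mul_gen]
  split_ifs
  · exact hm
  · simp

/-! ### Filtration of the free algebra -/

/-- The step `F^{m-1}` of the filtration of `T(V)`, with `F^{-1} = 0`. -/
def tfiltPred (k : Type u) [Field k] (V : Type u) [AddCommGroup V] [Module k V] :
    ℕ → Submodule k (TensorAlgebra k V)
  | 0 => ⊥
  | m + 1 => tfilt k V m

theorem tfilt_mono {V : Type u} [AddCommGroup V] [Module k V] {i j : ℕ} (h : i ≤ j) :
    tfilt k V i ≤ tfilt k V j :=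
  iSup₂_le fun a ha => le_iSup₂_of_le (f := fun (i : ℕ) (_ : i ≤ j) => tpow k V i) a
    (ha.trans h) le_rfl

theorem tfilt_induction {V : Type u} [AddCommGroup V] [Module k V] {m : ℕ}
    {S : Submodule k (TensorAlgebra k V)} (h : ∀ i ≤ m, tpow k V i ≤ S) : tfilt k V m ≤ S :=
  iSup₂_le h

theorem one_mem_tpow {V : Type u} [AddCommGroup V] [Module k V] :
    (1 : TensorAlgebra k V) ∈ tpow k V 0 := by
  rw [tpow, pow_zero]; exact Submodule.one_le.mp le_rfl

theorem mul_mem_tpow {V : Type u} [AddCommGroup V] [Module k V] {i j : ℕ}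
    {a b : TensorAlgebra k V} (ha : a ∈ tpow k V i) (hb : b ∈ tpow k V j) :
    a * b ∈ tpow k V (i + j) := by
  rw [tpow, pow_add]; exact Submodule.mul_mem_mul ha hb

theorem gen_mem_tpow (j : Fin n) : gen k j ∈ tpow k (Fin n → k) 1 := by
  rw [tpow, pow_one]; exact LinearMap.mem_range_self _ _

theorem tpow_mul_tfilt {V : Type u} [AddCommGroup V] [Module k V] {i j : ℕ}
    {a b : TensorAlgebra k V} (ha : a ∈ tpow k V i) (hb : b ∈ tfilt k V j) :
    a * b ∈ tfilt k V (i + j) := by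
  have : tfilt k V j ≤ (tfilt k V (i + j)).comap (LinearMap.mulLeft k a) :=
    tfilt_induction fun p hp c hc =>
      tfilt_mono (by omega) (tpow_le_tfilt (i + p) (mul_mem_tpow ha hc))
  exact this hb

theorem tfilt_mul_tpow {V : Type u} [AddCommGroup V] [Module k V] {i j : ℕ}
    {a b : TensorAlgebra k V} (ha : a ∈ tfilt k V i) (hb : b ∈ tpow k V j) :
    a * b ∈ tfilt k V (i + j) := by
  have : tfilt k V i ≤ (tfilt k V (i + j)).comap (LinearMap.mulRight k b) :=
    tfilt_induction fun p hp c hc =>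
      tfilt_mono (by omega) (tpow_le_tfilt (p + j) (mul_mem_tpow hc hb))
  exact this ha

/-- Induction on words, reading from the left. -/
theorem tpow_induction {p : ℕ → Submodule k (TensorAlgebra k (Fin n → k))} (h0 : 1 ∈ p 0)
    (hs : ∀ m, ∀ t ∈ tpow k (Fin n → k) m, t ∈ p m → ∀ j, t * gen k j ∈ p (m + 1)) (m : ℕ) :
    tpow k (Fin n → k) m ≤ p m := by
  induction m with
  | zero => rw [tpow, pow_zero]; exact Submodule.one_le.mpr h0
  | succ m ih =>
    rw [tpow, pow_succ]
    refine Submodule.mul_le.mpr ?_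
    rintro a ha _ ⟨w, rfl⟩
    rw [ι_eq_sum, Finset.mul_sum]
    refine Submodule.sum_mem _ fun j _ => ?_
    rw [mul_smul_comm]
    exact Submodule.smul_mem _ _ (hs m a ha (ih ha) j)

theorem tproj_of_mem {V : Type u} [AddCommGroup V] [Module k V] {m : ℕ} {t : TensorAlgebra k V}
    (h : t ∈ tpow k V m) : tproj k V m t = t := by
  simp [tproj, GradedAlgebra.proj_apply, DirectSum.decompose_of_mem_same _ h]

theorem tproj_of_mem_tfilt {V : Type u} [AddCommGroup V] [Module k V] {m : ℕ}
    {t : TensorAlgebra k V} (h : t ∈ tfilt k V m) : tproj k V (m + 1) t = 0 := by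
  have : tfilt k V m ≤ LinearMap.ker (tproj k V (m + 1)) := by
    refine tfilt_induction fun i hi a ha => ?_
    simp only [LinearMap.mem_ker, tproj, GradedAlgebra.proj_apply]
    exact DirectSum.decompose_of_mem_ne _ ha (by omega)
  exact this h

theorem eq_zero_of_mem_tpow_of_mem_tfiltPred {V : Type u} [AddCommGroup V] [Module k V] {m : ℕ}
    {t : TensorAlgebra k V} (h : t ∈ tpow k V m) (h' : t ∈ tfiltPred k V m) : t = 0 := by
  rw [← tproj_of_mem h]
  cases m with
  | zero => rw [(Submodule.mem_bot k).mp h', map_zero]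
  | succ m => exact tproj_of_mem_tfilt h'

end TensorAlgebra

end KoszulPBW

namespace KoszulPBW

/-! ### Normal forms and the PBW comparison -/

section NormalForm

variable {k : Type u} [Field k] {n : ℕ} (D : Darboux k n) (v : Fin n → k) (l : k)

/-- The indices other than the base index and its partner. -/
def Darboux.rest : Finset (Fin n) := (Finset.univ.erase D.base).erase (D.star D.base)

theorem Darboux.mem_rest {j : Fin n} : j ∈ D.rest ↔ j ≠ D.star D.base ∧ j ≠ D.base := by
  simp [Darboux.rest]

theorem Darboux.sum_eq {M : Type*} [AddCommGroup M] (f : Fin n → M) :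
    ∑ j, f j = f D.base + f (D.star D.base) + ∑ j ∈ D.rest, f j := by
  rw [Darboux.rest, add_assoc, Finset.add_sum_erase _ f
    (Finset.mem_erase.mpr ⟨(D.star_ne D.base), Finset.mem_univ _⟩),
    Finset.add_sum_erase _ f (Finset.mem_univ _)]

/-- The quadratic part of the rewriting of `x_base x_{star base}`. -/
def quadRest : TensorAlgebra k (Fin n → k) :=
  ∑ j ∈ D.rest, D.sgn j • (gen k j * gen k (D.star j))

/-- The part of degree at most one, free of `x_{star base}`, of the rewriting of
`x_base x_{star base}`. -/
def linRest : TensorAlgebra k (Fin n → k) :=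
  v D.base • gen k D.base + ∑ j ∈ D.rest, v j • gen k j + algebraMap k _ l

/-- The last identity is w times the relation solved for x_b x_{b*}. Together the three identities
define R by recursion on the last letter, and the recursion is realised by a right action of T(V) on
pairs (w, R w). -/
theorem exists_normalMul :
    ∃ R : TensorAlgebra k (Fin n → k) →ₗ[k] TensorAlgebra k (Fin n → k),
      R 1 = gen k (D.star D.base) ∧
      (∀ w j, j ≠ D.base → R (w * gen k j) = w * gen k j * gen k (D.star D.base)) ∧
      ∀ w, R (w * gen k D.base) =
        R w * gen k D.base + v (D.star D.base) • R w + w * (linRest D v l - quadRest D) := by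
  let T := TensorAlgebra k (Fin n → k)
  -- The operator of x_j computes (w x_j, R(w x_j)) from the pair (w, R w) alone.
  let A : Fin n → Module.End k (T × T) := fun j =>
    if j = D.base then
      LinearMap.prod (LinearMap.mulRight k (gen k D.base) ∘ₗ LinearMap.fst k T T)
        ((LinearMap.mulRight k (gen k D.base) + v (D.star D.base) • LinearMap.id) ∘ₗ
            LinearMap.snd k T T +
          LinearMap.mulRight k (linRest D v l - quadRest D) ∘ₗ LinearMap.fst k T T)
    else
      LinearMap.prod (LinearMap.mulRight k (gen k j) ∘ₗ LinearMap.fst k T T)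
        (LinearMap.mulRight k (gen k j * gen k (D.star D.base)) ∘ₗ LinearMap.fst k T T)
  let F : T →ₐ[k] (Module.End k (T × T))ᵐᵒᵖ := freeLift fun j => MulOpposite.op (A j)
  have hmul : ∀ t j p, (F (t * gen k j)).unop p = A j ((F t).unop p) := by
    intro t j p
    rw [map_mul, show F (gen k j) = MulOpposite.op (A j) from freeLift_gen _ _]
    rfl
  -- Along the orbit of (1, R 1) the first coordinate remembers the word, so the second coordinate
  -- is a function of it and can serve as R.
  have hfst : ∀ t : T, ((F t).unop (1, gen k (D.star D.base))).1 = t := by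
    intro t
    refine eq_top_of_mul_right_mem adjoin_gen (LinearMap.eqLocus
      (LinearMap.fst k T T ∘ₗ LinearMap.applyₗ ((1 : T), gen k (D.star D.base)) ∘ₗ
        (MulOpposite.opLinearEquiv k).symm.toLinearMap ∘ₗ F.toLinearMap) LinearMap.id) ?_ ?_ t
    · simp
    · intro a ha j
      simp only [LinearMap.mem_eqLocus, LinearMap.comp_apply, LinearMap.applyₗ_apply_apply,
        AlgHom.toLinearMap_apply, LinearEquiv.coe_coe, MulOpposite.coe_opLinearEquiv_symm,
        LinearMap.fst_apply, LinearMap.id_apply] at ha ⊢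
      rw [hmul]
      by_cases hj : j = D.base
      · subst hj; simp [A, ha]
      · simp [A, hj, ha]
  refine ⟨LinearMap.snd k T T ∘ₗ LinearMap.applyₗ ((1 : T), gen k (D.star D.base)) ∘ₗ
        (MulOpposite.opLinearEquiv k).symm.toLinearMap ∘ₗ F.toLinearMap, by simp, ?_, ?_⟩
  · intro w j hj
    simp only [LinearMap.comp_apply, LinearMap.applyₗ_apply_apply,
        AlgHom.toLinearMap_apply, LinearEquiv.coe_coe, MulOpposite.coe_opLinearEquiv_symm,
        LinearMap.snd_apply]
    rw [hmul]
    simp [A, hj, hfst, mul_assoc]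
  · intro w
    simp only [LinearMap.comp_apply, LinearMap.applyₗ_apply_apply,
        AlgHom.toLinearMap_apply, LinearEquiv.coe_coe, MulOpposite.coe_opLinearEquiv_symm,
        LinearMap.snd_apply]
    rw [hmul]
    simp [A, hfst]

/-- Right multiplication by `x_{star base}` on normal forms. -/
noncomputable def normalMul : TensorAlgebra k (Fin n → k) →ₗ[k] TensorAlgebra k (Fin n → k) :=
  (exists_normalMul D v l).choose

theorem normalMul_one : normalMul D v l 1 = gen k (D.star D.base) :=
  (exists_normalMul D v l).choose_spec.1

theorem normalMul_mul_gen (w : TensorAlgebra k (Fin n → k)) {j : Fin n} (hj : j ≠ D.base) :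
    normalMul D v l (w * gen k j) = w * gen k j * gen k (D.star D.base) :=
  (exists_normalMul D v l).choose_spec.2.1 w j hj

theorem normalMul_mul_gen_base (w : TensorAlgebra k (Fin n → k)) :
    normalMul D v l (w * gen k D.base) = normalMul D v l w * gen k D.base +
      v (D.star D.base) • normalMul D v l w + w * (linRest D v l - quadRest D) :=
  (exists_normalMul D v l).choose_spec.2.2 w

/-- Right multiplication by the generator `x_j` on normal forms. -/
noncomputable def normalOp (j : Fin n) :
    TensorAlgebra k (Fin n → k) →ₗ[k] TensorAlgebra k (Fin n → k) :=
  if j = D.star D.base then normalMul D v l else LinearMap.mulRight k (gen k j)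

theorem normalOp_of_ne {j : Fin n} (hj : j ≠ D.star D.base) (w : TensorAlgebra k (Fin n → k)) :
    normalOp D v l j w = w * gen k j := by simp [normalOp, hj]

theorem normalOp_star_base : normalOp D v l (D.star D.base) = normalMul D v l := by
  simp [normalOp]

/-- The recursion for `normalMul` was built so that the relation holds on all of T(V), not only on
words avoiding x_b x_{b*}; no confluence argument is required. The opposite ring appears because the
operators act from the right. -/
theorem satisfiesRel_normalOp :
    SatisfiesRel D v l fun j => MulOpposite.op (normalOp D v l j) := by
  apply MulOpposite.unop_injective
  ext1 w
  simp only [Finset.unop_sum, MulOpposite.unop_smul, MulOpposite.unop_mul,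
    MulOpposite.unop_op, LinearMap.coe_sum, Finset.sum_apply, LinearMap.smul_apply,
    Module.End.mul_apply, MulOpposite.unop_add, LinearMap.add_apply, MulOpposite.algebraMap_apply,
    Module.algebraMap_end_apply]
  rw [D.sum_eq, D.sum_eq, D.star_star, D.sgn_star, D.sgn_base, one_smul, neg_smul, one_smul,
    normalOp_star_base, normalOp_of_ne D v l (D.star_ne D.base).symm,
    normalOp_of_ne D v l (D.star_ne D.base).symm, normalMul_mul_gen_base]
  have h1 : ∑ j ∈ D.rest, D.sgn j • normalOp D v l (D.star j) (normalOp D v l j w) =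
      w * quadRest D := by
    rw [quadRest, Finset.mul_sum]
    refine Finset.sum_congr rfl fun j hj => ?_
    rw [D.mem_rest] at hj
    rw [normalOp_of_ne D v l hj.1, normalOp_of_ne D v l (D.star_ne_star_base hj.2),
      mul_smul_comm, mul_assoc]
  have h2 : v D.base • (w * gen k D.base) + ∑ j ∈ D.rest, v j • normalOp D v l j w + l • w =
      w * linRest D v l := by
    simp only [linRest, mul_add, mul_smul_comm, Finset.mul_sum, ← Algebra.commutes l w,
      ← Algebra.smul_def]
    congr 2
    refine Finset.sum_congr rfl fun j hj => ?_
    rw [normalOp_of_ne D v l (D.mem_rest.mp hj).1]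
  rw [h1, mul_sub, ← h2]
  abel

variable {D v l}

/-- The section is a ↦ 1 · a for the right action of U on T(V) through `normalOp`. It is a section
because T(V) → U intertwines `normalOp` with right multiplication in U, which for x_{b*} uses the
relation. -/
theorem Presents.exists_normalForm {U : Type u} [Ring U] [Algebra k U] {x : Fin n → U}
    (hx : Presents D v l x) :
    ∃ s : U →ₗ[k] TensorAlgebra k (Fin n → k), s 1 = 1 ∧
      (∀ a j, s (a * x j) = normalOp D v l j (s a)) ∧ ∀ a, freeLift x (s a) = a := by
  obtain ⟨f, hf⟩ := hx.lift _ _ (satisfiesRel_normalOp D v l)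
  have hR : ∀ w, freeLift x (normalMul D v l w) = freeLift x w * x (D.star D.base) := by
    refine eq_top_of_mul_right_mem adjoin_gen (LinearMap.eqLocus
      ((freeLift x).toLinearMap ∘ₗ normalMul D v l)
      (LinearMap.mulRight k (x (D.star D.base)) ∘ₗ (freeLift x).toLinearMap)) ?_ ?_
    · simp [normalMul_one]
    · intro a ha j
      simp only [LinearMap.mem_eqLocus, LinearMap.comp_apply, AlgHom.toLinearMap_apply,
        LinearMap.mulRight_apply] at ha ⊢
      by_cases hj : j = D.base
      · subst hj
        have h := hx.rel
        rw [SatisfiesRel, D.sum_eq, D.sum_eq, D.star_star, D.sgn_star, D.sgn_base, one_smul,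
          neg_smul, one_smul] at h
        have h1 : freeLift x (linRest D v l) - freeLift x (quadRest D) =
            x D.base * x (D.star D.base) - x (D.star D.base) * x D.base
              - v (D.star D.base) • x (D.star D.base) := by
          simp only [linRest, quadRest, map_add, map_smul, map_sum, map_mul, freeLift_gen,
            AlgHom.commutes]
          rw [← sub_eq_zero] at h ⊢
          rw [← neg_eq_zero, ← h]
          abel
        rw [normalMul_mul_gen_base]
        simp only [map_add, map_mul, map_smul, map_sub, ha, freeLift_gen, h1]
        simp only [mul_sub, mul_assoc, mul_smul_comm]
        abel
      · rw [normalMul_mul_gen D v l a hj]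
        simp
  have hop : ∀ j w, freeLift x (normalOp D v l j w) = freeLift x w * x j := by
    intro j w
    by_cases hj : j = D.star D.base
    · subst hj; rw [normalOp_star_base, hR]
    · rw [normalOp_of_ne D v l hj]; simp
  refine ⟨LinearMap.applyₗ (1 : TensorAlgebra k (Fin n → k)) ∘ₗ
        (MulOpposite.opLinearEquiv k).symm.toLinearMap ∘ₗ f.toLinearMap, by simp, ?_, ?_⟩
  · intro a j
    simp [hf]
  · refine eq_top_of_mul_right_mem hx.adjoin_eq_top (LinearMap.eqLocus ((freeLift x).toLinearMap ∘ₗ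
      LinearMap.applyₗ (1 : TensorAlgebra k (Fin n → k)) ∘ₗ
        (MulOpposite.opLinearEquiv k).symm.toLinearMap ∘ₗ f.toLinearMap) LinearMap.id) ?_ ?_
    · simp
    · intro a ha j
      simp only [LinearMap.mem_eqLocus, LinearMap.comp_apply, LinearMap.applyₗ_apply_apply,
        AlgHom.toLinearMap_apply, LinearEquiv.coe_coe, MulOpposite.coe_opLinearEquiv_symm,
        LinearMap.id_apply] at ha ⊢
      rw [map_mul, hf, MulOpposite.unop_mul, MulOpposite.unop_op, Module.End.mul_apply, hop, ha]

/-- The normal form section `U → T(V)` of the presentation. -/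
noncomputable def Presents.normalForm {U : Type u} [Ring U] [Algebra k U] {x : Fin n → U}
    (hx : Presents D v l x) : U →ₗ[k] TensorAlgebra k (Fin n → k) :=
  hx.exists_normalForm.choose

section

variable {U : Type u} [Ring U] [Algebra k U] {x : Fin n → U} (hx : Presents D v l x)
include hx

theorem Presents.normalForm_one : hx.normalForm 1 = 1 := hx.exists_normalForm.choose_spec.1

theorem Presents.normalForm_mul (a : U) (j : Fin n) :
    hx.normalForm (a * x j) = normalOp D v l j (hx.normalForm a) :=
  hx.exists_normalForm.choose_spec.2.1 a j

theorem Presents.freeLift_normalForm (a : U) : freeLift x (hx.normalForm a) = a :=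
  hx.exists_normalForm.choose_spec.2.2 a

theorem Presents.normalForm_mul_base (a : U) :
    hx.normalForm (a * x D.base) = hx.normalForm a * gen k D.base := by
  rw [hx.normalForm_mul, normalOp_of_ne D v l (D.star_ne D.base).symm]

/-- On normal forms, right multiplication by x_b merely appends a letter, and the right derivative
removes it again. -/
theorem Presents.mul_base_injective {a : U} (h : a * x D.base = 0) : a = 0 := by
  have h1 := congrArg (rightDeriv D.base) (hx.normalForm_mul_base a)
  rw [h, map_zero, map_zero, rightDeriv_mul_gen, if_pos rfl] at h1
  rw [← hx.freeLift_normalForm a, ← h1, map_zero]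

end

/-! ### Degrees of normal forms -/

theorem normalMul_zero_mem_tpow (D : Darboux k n) (m : ℕ) {t : TensorAlgebra k (Fin n → k)}
    (ht : t ∈ tpow k (Fin n → k) m) : normalMul D 0 0 t ∈ tpow k (Fin n → k) (m + 1) := by
  refine tpow_induction (p := fun m => (tpow k (Fin n → k) (m + 1)).comap (normalMul D 0 0))
    ?_ ?_ m ht
  · rw [Submodule.mem_comap, normalMul_one]; exact gen_mem_tpow _
  · intro m t ht ih j
    rw [Submodule.mem_comap] at ih ⊢
    by_cases hj : j = D.base
    · subst hj
      rw [normalMul_mul_gen_base]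
      simp only [linRest, Pi.zero_apply, zero_smul, map_zero, Finset.sum_const_zero, add_zero,
        zero_sub]
      refine Submodule.add_mem _ (mul_mem_tpow ih (gen_mem_tpow _))
        (mul_mem_tpow (i := m) (j := 2) ht (Submodule.neg_mem _ ?_))
      exact Submodule.sum_mem _ fun j _ => Submodule.smul_mem _ _
        (mul_mem_tpow (i := 1) (j := 1) (gen_mem_tpow _) (gen_mem_tpow _))
    · rw [normalMul_mul_gen _ _ _ _ hj]
      exact mul_mem_tpow (mul_mem_tpow ht (gen_mem_tpow _)) (gen_mem_tpow _)

theorem linRest_mem_tfilt (D : Darboux k n) (v : Fin n → k) (l : k) :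
    linRest D v l ∈ tfilt k (Fin n → k) 1 := by
  have h1 : ∀ j, gen k j ∈ tfilt k (Fin n → k) 1 := fun j => tpow_le_tfilt 1 (gen_mem_tpow j)
  refine Submodule.add_mem _ (Submodule.add_mem _ (Submodule.smul_mem _ _ (h1 _))
    (Submodule.sum_mem _ fun j _ => Submodule.smul_mem _ _ (h1 j))) ?_
  rw [Algebra.algebraMap_eq_smul_one]
  exact Submodule.smul_mem _ _ (tfilt_mono (Nat.zero_le 1) (tpow_le_tfilt 0 one_mem_tpow))

/-- Only the rewriting step sees v and λ, and there they replace two letters by at most one. -/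
theorem normalMul_sub_mem_tfilt (D : Darboux k n) (v : Fin n → k) (l : k) (m : ℕ)
    {t : TensorAlgebra k (Fin n → k)} (ht : t ∈ tpow k (Fin n → k) m) :
    normalMul D v l t - normalMul D 0 0 t ∈ tfilt k (Fin n → k) m := by
  refine tpow_induction
    (p := fun m => (tfilt k (Fin n → k) m).comap (normalMul D v l - normalMul D 0 0)) ?_ ?_ m ht
  · simp [normalMul_one]
  · intro m t ht ih j
    rw [Submodule.mem_comap, LinearMap.sub_apply] at ih ⊢
    by_cases hj : j = D.base
    · subst hj
      have h0 := tpow_le_tfilt _ (normalMul_zero_mem_tpow D m ht)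
      have h1 : normalMul D v l t ∈ tfilt k (Fin n → k) (m + 1) := by
        have := Submodule.add_mem _ (tfilt_mono (Nat.le_succ m) ih) h0
        rwa [sub_add_cancel] at this
      have h2 : normalMul D v l (t * gen k D.base) - normalMul D 0 0 (t * gen k D.base) =
          (normalMul D v l t - normalMul D 0 0 t) * gen k D.base +
            v (D.star D.base) • normalMul D v l t + t * linRest D v l := by
        rw [normalMul_mul_gen_base, normalMul_mul_gen_base]
        simp only [linRest, Pi.zero_apply, zero_smul, map_zero, Finset.sum_const_zero, add_zero,
          mul_sub, sub_mul, mul_zero]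
        abel
      rw [h2]
      exact Submodule.add_mem _ (Submodule.add_mem _ (tfilt_mul_tpow ih (gen_mem_tpow _))
        (Submodule.smul_mem _ _ h1)) (tpow_mul_tfilt ht (linRest_mem_tfilt D v l))
    · simp [normalMul_mul_gen _ _ _ _ hj]

theorem normalOp_zero_mem_tpow (D : Darboux k n) (j : Fin n) {m : ℕ}
    {t : TensorAlgebra k (Fin n → k)} (ht : t ∈ tpow k (Fin n → k) m) :
    normalOp D 0 0 j t ∈ tpow k (Fin n → k) (m + 1) := by
  by_cases hj : j = D.star D.base
  · subst hj; rw [normalOp_star_base]; exact normalMul_zero_mem_tpow D m ht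
  · rw [normalOp_of_ne _ _ _ hj]; exact mul_mem_tpow ht (gen_mem_tpow j)

theorem normalOp_sub_mem_tfilt (D : Darboux k n) (v : Fin n → k) (l : k) (j : Fin n) {m : ℕ}
    {t : TensorAlgebra k (Fin n → k)} (ht : t ∈ tpow k (Fin n → k) m) :
    normalOp D v l j t - normalOp D 0 0 j t ∈ tfilt k (Fin n → k) m := by
  by_cases hj : j = D.star D.base
  · subst hj; simp only [normalOp_star_base]; exact normalMul_sub_mem_tfilt D v l m ht
  · simp [normalOp_of_ne _ _ _ hj]

theorem normalOp_mem_tfiltPred (D : Darboux k n) (v : Fin n → k) (l : k) (j : Fin n) {m : ℕ}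
    {t : TensorAlgebra k (Fin n → k)} (ht : t ∈ tfiltPred k (Fin n → k) m) :
    normalOp D v l j t ∈ tfilt k (Fin n → k) m := by
  cases m with
  | zero => rw [(Submodule.mem_bot k).mp ht, map_zero]; exact Submodule.zero_mem _
  | succ m =>
    refine (tfilt_induction (S := (tfilt k (Fin n → k) (m + 1)).comap (normalOp D v l j))
      fun i hi a ha => ?_) ht
    have := Submodule.add_mem _ (tfilt_mono (Nat.le_succ i) (normalOp_sub_mem_tfilt D v l j ha))
      (tpow_le_tfilt _ (normalOp_zero_mem_tpow D j ha))
    rw [sub_add_cancel] at this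
    exact tfilt_mono (by omega) this

section

variable {U A : Type u} [Ring U] [Algebra k U] [Ring A] [Algebra k A] {x : Fin n → U}
  {y : Fin n → A} (hy : Presents D 0 0 y)

theorem Presents.normalForm_mem_tpow (m : ℕ) {t : TensorAlgebra k (Fin n → k)}
    (ht : t ∈ tpow k (Fin n → k) m) :
    hy.normalForm (freeLift y t) ∈ tpow k (Fin n → k) m := by
  refine tpow_induction (p := fun m => (tpow k (Fin n → k) m).comap
    (hy.normalForm ∘ₗ (freeLift y).toLinearMap)) ?_ ?_ m ht
  · simp [hy.normalForm_one]
  · intro m t _ ih j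
    simp only [Submodule.mem_comap, LinearMap.comp_apply, AlgHom.toLinearMap_apply, map_mul,
      freeLift_gen, hy.normalForm_mul] at ih ⊢
    exact normalOp_zero_mem_tpow D j ih

variable (hx : Presents D v l x)
include hx hy

theorem Presents.normalForm_sub_mem_tfiltPred (m : ℕ) {t : TensorAlgebra k (Fin n → k)}
    (ht : t ∈ tpow k (Fin n → k) m) :
    hx.normalForm (freeLift x t) - hy.normalForm (freeLift y t) ∈ tfiltPred k (Fin n → k) m := by
  refine tpow_induction (p := fun m => (tfiltPred k (Fin n → k) m).comap
    (hx.normalForm ∘ₗ (freeLift x).toLinearMap - hy.normalForm ∘ₗ (freeLift y).toLinearMap))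
    ?_ ?_ m ht
  · simp [hx.normalForm_one, hy.normalForm_one]
  · intro m t ht ih j
    simp only [Submodule.mem_comap, LinearMap.comp_apply, AlgHom.toLinearMap_apply, map_mul,
      freeLift_gen, hy.normalForm_mul, hx.normalForm_mul, LinearMap.sub_apply] at ih ⊢
    have h1 := normalOp_mem_tfiltPred D v l j ih
    have h2 := normalOp_sub_mem_tfilt D v l j (hy.normalForm_mem_tpow m ht)
    have := Submodule.add_mem _ h1 h2
    rw [map_sub, sub_add_sub_cancel] at this
    exact this

theorem Presents.normalForm_mem_tfiltPred (m : ℕ) {t : TensorAlgebra k (Fin n → k)}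
    (ht : t ∈ tfiltPred k (Fin n → k) m) :
    hx.normalForm (freeLift x t) ∈ tfiltPred k (Fin n → k) m := by
  cases m with
  | zero =>
    rw [(Submodule.mem_bot k).mp ht, map_zero, map_zero]; exact Submodule.zero_mem _
  | succ m =>
    refine (tfilt_induction (S := (tfilt k (Fin n → k) m).comap
      (hx.normalForm ∘ₗ (freeLift x).toLinearMap)) fun i hi a ha => ?_) ht
    have h1 := hy.normalForm_sub_mem_tfiltPred hx i ha
    have h2 := tfilt_mono hi (tpow_le_tfilt _ (hy.normalForm_mem_tpow i ha))
    have h3 : tfiltPred k (Fin n → k) i ≤ tfilt k (Fin n → k) m := by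
      cases i with
      | zero => exact bot_le
      | succ i => exact tfilt_mono (by omega)
    have := Submodule.add_mem _ (h3 h1) h2
    rw [sub_add_cancel] at this
    exact this

/-- The PBW property: a homogeneous element drops in filtration in `U` exactly when it vanishes in
the homogeneous algebra. -/
theorem Presents.freeLift_eq_zero_iff (m : ℕ) {t : TensorAlgebra k (Fin n → k)}
    (ht : t ∈ tpow k (Fin n → k) m) :
    freeLift y t = 0 ↔ freeLift x t ∈ (tfiltPred k (Fin n → k) m).map (freeLift x).toLinearMap := by
  have h1 := hy.normalForm_sub_mem_tfiltPred hx m ht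
  constructor
  · intro h
    rw [h, map_zero, sub_zero] at h1
    exact ⟨_, h1, hx.freeLift_normalForm _⟩
  · rintro ⟨t', ht', e⟩
    have h2 := hy.normalForm_mem_tfiltPred hx m ht'
    rw [AlgHom.toLinearMap_apply] at e
    rw [e] at h2
    have h3 := Submodule.sub_mem _ h2 h1
    rw [sub_sub_cancel] at h3
    -- The normal form in the homogeneous algebra has degree exactly m, but now also lies in degrees
    -- below m.
    have h4 := eq_zero_of_mem_tpow_of_mem_tfiltPred (hy.normalForm_mem_tpow m ht) h3
    rw [← hy.freeLift_normalForm (freeLift y t), h4, map_zero]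

end

end NormalForm

end KoszulPBW

namespace KoszulPBW

open MulOpposite

/-! ### Derivations prescribed on the generators -/

section Derivation

variable {k : Type u} [Field k] {n : ℕ} {D : Darboux k n} {v : Fin n → k} {l : k}

/-- The diagonal entries of the relation hold because f and g are representations; the condition
`he` is exactly its off-diagonal entry. -/
theorem SatisfiesRel.upperTriangular {U M S : Type*} [Ring U] [Algebra k U] {x : Fin n → U}
    (hx : SatisfiesRel D v l x)
    [AddCommGroup M] [Module k M] [AddCommGroup S] [Module k S]
    (f : U →ₐ[k] Module.End k M) (g : U →ₐ[k] Module.End k S) (e : Fin n → S →ₗ[k] M)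
    (he : ∀ s, ∑ j, D.sgn j • (f (x j) (e (D.star j) s) + e j (g (x (D.star j)) s)) =
      ∑ j, v j • e j s) :
    SatisfiesRel D v l fun j => upperTriangular (f (x j)) (e j) (g (x j)) := by
  have hf := congrArg f hx
  have hg := congrArg g hx
  simp only [map_add, map_sum, map_smul, map_mul, AlgHom.commutes] at hf hg
  refine LinearMap.ext fun ⟨m, s⟩ => Prod.ext ?_ ?_
  · have := LinearMap.congr_fun hf m
    simp only [LinearMap.add_apply, LinearMap.sum_apply, LinearMap.smul_apply,
      Module.End.mul_apply] at this
    simp only [upperTriangular_apply, LinearMap.add_apply, LinearMap.sum_apply,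
      LinearMap.smul_apply, Module.End.mul_apply, Prod.fst_add, Prod.fst_sum, Prod.smul_fst,
      Module.algebraMap_end_apply, map_add, smul_add, Finset.sum_add_distrib] at this he ⊢
    rw [add_assoc, he, this]
    abel
  · have := LinearMap.congr_fun hg s
    simp only [LinearMap.add_apply, LinearMap.sum_apply, LinearMap.smul_apply,
      Module.End.mul_apply, Module.algebraMap_end_apply] at this
    simpa [upperTriangular_apply, Prod.snd_sum, Module.algebraMap_end_apply] using this

theorem Presents.exists_derivation {U M S : Type u} [Ring U] [Algebra k U] {x : Fin n → U}
    (hx : Presents D v l x)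
    [AddCommGroup M] [Module k M] [AddCommGroup S] [Module k S]
    (f : U →ₐ[k] Module.End k M) (g : U →ₐ[k] Module.End k S) (e : Fin n → S →ₗ[k] M)
    (he : ∀ s, ∑ j, D.sgn j • (f (x j) (e (D.star j) s) + e j (g (x (D.star j)) s)) =
      ∑ j, v j • e j s) :
    ∃ Δ : U →ₗ[k] S →ₗ[k] M, Δ 1 = 0 ∧ (∀ j, Δ (x j) = e j) ∧
      ∀ a b s, Δ (a * b) s = f a (Δ b s) + Δ a (g b s) := by
  obtain ⟨F, hF⟩ := hx.lift _ _ (hx.rel.upperTriangular f g e he)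
  exact KoszulPBW.exists_derivation hx.adjoin_eq_top f g e F hF

end Derivation

/-! ### The coefficients d and c over the enveloping algebra -/

section EnvelopingRing

variable {k : Type u} [Field k] {n : ℕ} {D : Darboux k n} {v : Fin n → k} {l : k}
  {E : Type u} [Ring E] [Algebra k E]

/-- The coefficients of the second differential of the bimodule resolution, in terms of those of
the first. -/
def symCoeff (D : Darboux k n) (v : Fin n → k) (d : Fin n → E) (j : Fin n) : E :=
  -(D.sgn j • d (D.star j)) - v j • 1

/-- The mixed terms cancel under j ↔ j*, since the signs are antisymmetric and p commutes with q. -/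
theorem sum_sub_mul_sub (D : Darboux k n) (p q : Fin n → E) (h : ∀ i j, p i * q j = q j * p i) :
    ∑ j, D.sgn j • ((p j - q j) * (p (D.star j) - q (D.star j))) =
      ∑ j, D.sgn j • (p j * p (D.star j)) + ∑ j, D.sgn j • (q j * q (D.star j)) := by
  have h3 : ∑ j, D.sgn j • (q j * p (D.star j)) = -∑ j, D.sgn j • (p j * q (D.star j)) := by
    rw [← D.sum_star, ← Finset.sum_neg_distrib]
    simp only [D.star_star, D.sgn_star, neg_smul, h]
  simp only [sub_mul, mul_sub, smul_sub, Finset.sum_sub_distrib, h3]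
  abel

theorem symCoeff_eq (d : Fin n → E) (j : Fin n) :
    symCoeff D v d j = (-D.sgn j) • d (D.star j) - v j • 1 := by
  rw [symCoeff, neg_smul]

theorem symCoeff_star_base (d : Fin n → E) :
    symCoeff D v d (D.star D.base) = d D.base - v (D.star D.base) • 1 := by
  simp [symCoeff, D.star_star, D.sgn_star, D.sgn_base]

theorem sum_symCoeff_mul {d : Fin n → E}
    (h : ∑ j, D.sgn j • (d j * d (D.star j)) = ∑ j, v j • d j) :
    ∑ j, symCoeff D v d j * d j = 0 := by
  simp only [symCoeff, sub_mul, neg_mul, smul_mul_assoc, one_mul, Finset.sum_sub_distrib,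
    Finset.sum_neg_distrib]
  rw [← h, ← D.sum_star fun j => D.sgn j • (d (D.star j) * d j)]
  simp only [D.star_star, D.sgn_star, neg_smul, Finset.sum_neg_distrib, neg_neg, sub_self]

variable {U : Type u} [Ring U] [Algebra k U] {x : Fin n → U}
  (i : U →ₐ[k] E) (o : Uᵐᵒᵖ →ₐ[k] E) (hio : ∀ a b, i a * o b = o b * i a)

include hio in
-- Reversing products changes the sign of the form, so the relation in the opposite factor enters
-- with a minus sign. The linear parts combine to ∑ v_j d_j and the constants cancel.
theorem SatisfiesRel.sum_sub (hx : SatisfiesRel D v l x) :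
    ∑ j, D.sgn j • ((i (x j) - o (op (x j))) * (i (x (D.star j)) - o (op (x (D.star j))))) =
      ∑ j, v j • (i (x j) - o (op (x j))) := by
  have h4 : ∑ j, D.sgn j • (o (op (x j)) * o (op (x (D.star j)))) =
      -o (op (∑ j, D.sgn j • (x j * x (D.star j)))) := by
    rw [← D.sum_star]
    simp only [D.star_star, D.sgn_star, neg_smul, Finset.sum_neg_distrib, ← map_mul, ← op_mul,
      ← map_smul, ← op_smul, ← map_sum, ← Finset.op_sum, map_neg]
  have h5 : ∑ j, D.sgn j • (i (x j) * i (x (D.star j))) =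
      i (∑ j, D.sgn j • (x j * x (D.star j))) := by
    simp only [map_sum, map_smul, map_mul]
  rw [sum_sub_mul_sub D (fun j => i (x j)) (fun j => o (op (x j))) fun _ _ => hio _ _, h4, h5, hx]
  simp only [map_add, map_sum, map_smul, op_add, Finset.op_sum, op_smul, smul_sub,
    Finset.sum_sub_distrib, AlgHom.commutes, ← MulOpposite.algebraMap_apply]
  abel

include hio in
-- A bimodule derivation with Δ(x_j) = q_j exists as soon as the linearised relation holds, and that
-- relation is ∑ c_j q_j = 0 multiplied by elements of the opposite factor.
theorem Presents.exists_bimod_derivation (hx : Presents D v l x) {M : Type u} [AddCommGroup M]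
    [Module k M] [Module E M] [IsScalarTower k E M] (q : Fin n → M)
    (hq : ∑ j, symCoeff D v (fun j => i (x j) - o (op (x j))) j • q j = 0) :
    ∃ Δ : U →ₗ[k] M, Δ 1 = 0 ∧ ∀ j b, Δ (x j * b) = i (x j) • Δ b + o (op b) • q j := by
  let ρ : U →ₐ[k] Module.End k M := (Algebra.lsmul k k M).comp i
  let e : Fin n → U →ₗ[k] M := fun j =>
    ((Algebra.lsmul k k M).toLinearMap.flip (q j)) ∘ₗ o.toLinearMap ∘ₗ
      (opLinearEquiv k).toLinearMap
  have hρ : ∀ a m, ρ a m = i a • m := fun _ _ => rfl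
  have he : ∀ j b, e j b = o (op b) • q j := fun _ _ => rfl
  obtain ⟨Δ, h1, hΔ, hm⟩ := hx.exists_derivation ρ (Algebra.lmul k U) e (by
    intro b
    have h : ∑ j, D.sgn j • (ρ (x j) (e (D.star j) b)) =
        -∑ j, D.sgn j • (o (op b) * i (x (D.star j))) • q j := by
      rw [← D.sum_star]
      simp only [hρ, he, D.star_star, D.sgn_star, neg_smul, Finset.sum_neg_distrib, smul_smul, hio]
    have h' : ∀ j, o (op b) • symCoeff D v (fun j => i (x j) - o (op (x j))) j • q j =
        -(D.sgn j • (o (op b) * i (x (D.star j))) • q j) +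
          D.sgn j • (o (op b) * o (op (x (D.star j)))) • q j - v j • o (op b) • q j := by
      intro j
      rw [smul_smul, symCoeff, mul_sub, mul_neg, mul_smul_comm, mul_smul_comm, mul_one, sub_smul,
        neg_smul, smul_assoc, smul_assoc, mul_sub, sub_smul, smul_sub]
      abel
    have h'' := congrArg (o (op b) • ·) hq
    simp only [smul_zero, Finset.smul_sum, h', Finset.sum_sub_distrib, Finset.sum_add_distrib,
      Finset.sum_neg_distrib] at h''
    simp only [smul_add, Finset.sum_add_distrib, h]
    simp only [he, Algebra.coe_lmul_eq_mul, LinearMap.mul_apply', op_mul, map_mul]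
    exact sub_eq_zero.mp h'')
  refine ⟨Δ.flip 1, by simp [h1], fun j b => ?_⟩
  simp [hm, hΔ, hρ, he]

end EnvelopingRing

/-! ### Exactness of the bimodule resolution -/

section Bimodule

variable {k : Type u} [Field k] {U : Type u} [Ring U] [Algebra k U]

/-- The element `a ⊗ 1 - 1 ⊗ a` of the enveloping algebra. -/
def envD (k : Type u) [Field k] {U : Type u} [Ring U] [Algebra k U] : U →ₗ[k] Env k U :=
  (Algebra.TensorProduct.includeLeft (R := k) (S := k) (A := U) (B := Uᵐᵒᵖ)).toLinearMap -
    (Algebra.TensorProduct.includeRight (R := k) (A := U) (B := Uᵐᵒᵖ)).toLinearMap ∘ₗ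
      (opLinearEquiv k).toLinearMap

theorem envD_apply (a : U) : envD k a = a ⊗ₜ 1 - 1 ⊗ₜ op a := rfl

theorem tmul_mul_envD (a c : U) (b : Uᵐᵒᵖ) :
    (a ⊗ₜ b : Env k U) * envD k c = (a * c) ⊗ₜ b - a ⊗ₜ (b * op c) := by
  simp [envD_apply, mul_sub]

/-- Evaluation at `1`, the augmentation `U ⊗ Uᵒᵖ → U` of the bimodule resolution. -/
noncomputable def envAug (k : Type u) [Field k] (U : Type u) [Ring U] [Algebra k U] :
    Env k U →ₗ[Env k U] selfBimod k U :=
  LinearMap.toSpanSingleton (Env k U) (selfBimod k U) (show selfBimod k U from (1 : U))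

theorem envAug_tmul (a : U) (b : Uᵐᵒᵖ) :
    envAug k U (a ⊗ₜ b) = (show selfBimod k U from a * unop b) := by
  rw [envAug, LinearMap.toSpanSingleton_apply, selfBimod_smul, mul_one]

theorem envAug_surjective : Function.Surjective (envAug k U) := fun a =>
  ⟨(show U from a) ⊗ₜ 1, by rw [envAug_tmul, unop_one, mul_one]⟩

theorem envAug_envD (a : U) : envAug k U (envD k a) = 0 := by
  rw [envD_apply, map_sub, envAug_tmul, envAug_tmul, unop_one, unop_op, mul_one, one_mul]
  exact sub_self _

variable {n : ℕ} {x : Fin n → U}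

theorem envD_mem_span (gen : Algebra.adjoin k (Set.range x) = ⊤) (a : U) :
    envD k a ∈ Submodule.span (Env k U) (Set.range fun j => envD k (x j)) := by
  have ha : a ∈ Algebra.adjoin k (Set.range x) := gen ▸ Algebra.mem_top
  induction ha using Algebra.adjoin_induction with
  | mem y hy => obtain ⟨j, rfl⟩ := hy; exact Submodule.subset_span ⟨j, rfl⟩
  | algebraMap r =>
    have : envD k (algebraMap k U r) = 0 := by
      rw [envD_apply, Algebra.algebraMap_eq_smul_one, op_smul, op_one, TensorProduct.smul_tmul, sub_self]
    rw [this]; exact Submodule.zero_mem _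
  | add y z _ _ hy hz => rw [map_add]; exact Submodule.add_mem _ hy hz
  | mul y z _ _ hy hz =>
    have : envD k (y * z) = (1 ⊗ₜ op z : Env k U) • envD k y + (y ⊗ₜ 1 : Env k U) • envD k z := by
      simp [envD_apply, mul_sub]
    rw [this]
    exact Submodule.add_mem _ (Submodule.smul_mem _ _ hy) (Submodule.smul_mem _ _ hz)

/-- Modulo the left ideal of the d_j one has a ⊗ b ≡ ab ⊗ 1, so f is congruent to its augmentation
tensor 1. -/
theorem ker_envAug (gen : Algebra.adjoin k (Set.range x) = ⊤) {f : Env k U}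
    (hf : envAug k U f = 0) : ∃ g : Fin n → Env k U, f = ∑ j, g j * envD k (x j) := by
  have key : ∀ f : Env k U, f - (show U from envAug k U f) ⊗ₜ 1 ∈
      Submodule.span (Env k U) (Set.range fun j => envD k (x j)) := by
    intro f
    induction f using TensorProduct.induction_on with
    | zero =>
      rw [map_zero]
      have : ((show U from (0 : selfBimod k U)) ⊗ₜ 1 : Env k U) = 0 := TensorProduct.zero_tmul _ _
      rw [this, sub_zero]; exact Submodule.zero_mem _
    | tmul a b =>
      rw [envAug_tmul]
      have := Submodule.smul_mem _ (a ⊗ₜ 1 : Env k U) (envD_mem_span gen (unop b))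
      rw [smul_eq_mul, tmul_mul_envD, op_unop, one_mul] at this
      rw [← neg_mem_iff, neg_sub]
      exact this
    | add f g hf hg =>
      have h : ((show U from envAug k U (f + g)) ⊗ₜ 1 : Env k U) =
          (show U from envAug k U f) ⊗ₜ 1 + (show U from envAug k U g) ⊗ₜ 1 := by
        rw [map_add]; exact TensorProduct.add_tmul _ _ _
      rw [h, add_sub_add_comm]
      exact Submodule.add_mem _ hf hg
  have h := key f
  rw [hf, show ((show U from (0 : selfBimod k U)) ⊗ₜ 1 : Env k U) = 0 from
    TensorProduct.zero_tmul _ _, sub_zero] at h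
  obtain ⟨g, hg⟩ := (Submodule.mem_span_range_iff_exists_fun (Env k U)).mp h
  exact ⟨g, hg.symm⟩

variable {D : Darboux k n} {v : Fin n → k} {l : k}


theorem SatisfiesRel.sum_envD (hx : SatisfiesRel D v l x) :
    ∑ j, D.sgn j • (envD k (x j) * envD k (x (D.star j))) = ∑ j, v j • envD k (x j) :=
  hx.sum_sub (Algebra.TensorProduct.includeLeft (R := k) (S := k) (A := U) (B := Uᵐᵒᵖ))
    (Algebra.TensorProduct.includeRight (R := k) (A := U) (B := Uᵐᵒᵖ)) (by simp)

/-- Exactness of the bimodule resolution in degree one. -/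
theorem Presents.exists_eq_mul_symCoeff (hx : Presents D v l x) {f : Fin n → Env k U}
    (hf : ∑ j, f j * envD k (x j) = 0) :
    ∃ g, ∀ j, f j = g * symCoeff D v (fun j => envD k (x j)) j := by
  let N : Submodule (Env k U) (Fin n → Env k U) :=
    Submodule.span (Env k U) {symCoeff D v (fun j => envD k (x j))}
  -- The q_j satisfy ∑ c_j q_j = 0 by the choice of N, so there is a derivation into the quotient
  -- with Δ(x_j) = q_j.
  let q : Fin n → (Fin n → Env k U) ⧸ N := fun j => N.mkQ (Pi.single j 1)
  have hq : ∀ f : Fin n → Env k U, N.mkQ f = ∑ j, f j • q j := by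
    intro f
    simp only [q, ← map_smul, ← map_sum]
    congr 1
    ext i
    simp [Finset.sum_apply, Pi.single_apply]
  have hq0 : ∑ j, symCoeff D v (fun j => envD k (x j)) j • q j = 0 := by
    rw [← hq]
    exact (Submodule.Quotient.mk_eq_zero N).mpr (Submodule.mem_span_singleton_self _)
  obtain ⟨Δ, h1, hΔ⟩ := hx.exists_bimod_derivation
    (Algebra.TensorProduct.includeLeft (R := k) (S := k) (A := U) (B := Uᵐᵒᵖ))
    (Algebra.TensorProduct.includeRight (R := k) (A := U) (B := Uᵐᵒᵖ)) (by simp) q hq0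
  -- The map a ⊗ b ↦ a Δ(b) acts as a contracting homotopy: it sends f d_j to -f q_j, so ∑ f_j d_j =
  -- 0 forces the class of f to vanish.
  let h : Env k U →ₗ[k] (Fin n → Env k U) ⧸ N := TensorProduct.lift
    (((Algebra.lsmul k k ((Fin n → Env k U) ⧸ N)).toLinearMap.compl₂
      (Δ ∘ₗ (opLinearEquiv k).symm.toLinearMap)) ∘ₗ
      (Algebra.TensorProduct.includeLeft (R := k) (S := k) (A := U) (B := Uᵐᵒᵖ)).toLinearMap)
  have hh : ∀ a b, h (a ⊗ₜ b) = (a ⊗ₜ 1 : Env k U) • Δ (unop b) := fun _ _ => rfl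
  have key : ∀ (f : Env k U) j, h (f * envD k (x j)) = -(f • q j) := by
    intro f j
    induction f using TensorProduct.induction_on with
    | zero =>
      change h (0 * envD k (x j)) = -((0 : Env k U) • q j)
      rw [zero_mul, map_zero]
      exact (neg_eq_zero.mpr (zero_smul (Env k U) (q j))).symm
    | tmul a b =>
      rw [tmul_mul_envD, map_sub, hh, hh, unop_mul, unop_op, hΔ, smul_add, smul_smul, smul_smul]
      simp
    | add f g hf hg => rw [add_mul, map_add, hf, hg, add_smul, neg_add]
  have h0 : N.mkQ f = 0 := by
    rw [hq, ← neg_eq_zero, ← Finset.sum_neg_distrib, ← map_zero h, ← hf, map_sum]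
    exact Finset.sum_congr rfl fun j _ => (key _ _).symm
  obtain ⟨g, hg⟩ := Submodule.mem_span_singleton.mp ((Submodule.Quotient.mk_eq_zero N).mp h0)
  exact ⟨g, fun j => by rw [← hg]; rfl⟩

theorem map_pow_apply {A B : Type*} [AddCommGroup A] [Module k A] [AddCommGroup B] [Module k B]
    (f : Module.End k A) (g : Module.End k B) (m : ℕ) :
    TensorProduct.map f g ^ m = TensorProduct.map (f ^ m) (g ^ m) := by
  induction m with
  | zero => simp [Module.End.one_eq_id]
  | succ m ih => simp [pow_succ, ih, Module.End.mul_eq_comp, TensorProduct.map_comp]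

theorem map_locally_nilpotent {A B : Type*} [AddCommGroup A] [Module k A] [AddCommGroup B]
    [Module k B] (f : Module.End k A) (g : Module.End k B) (hf : ∀ a, ∃ m, (f ^ m) a = 0)
    (z : A ⊗[k] B) : ∃ m, (TensorProduct.map f g ^ m) z = 0 := by
  induction z using TensorProduct.induction_on with
  | zero => exact ⟨0, map_zero _⟩
  | tmul a b =>
    obtain ⟨m, hm⟩ := hf a
    exact ⟨m, by rw [map_pow_apply, TensorProduct.map_tmul, hm, TensorProduct.zero_tmul]⟩
  | add y z hy hz =>
    obtain ⟨p, hp⟩ := hy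
    obtain ⟨q, hq⟩ := hz
    refine ⟨p + q, ?_⟩
    rw [map_add, pow_add, Module.End.mul_apply, Module.End.mul_apply, hq, map_zero, add_zero,
      ← Module.End.mul_apply, ← pow_add, add_comm, pow_add, Module.End.mul_apply, hp, map_zero]

/-- Exactness of the bimodule resolution in degree two. -/
theorem Presents.eq_zero_of_mul_symCoeff (hx : Presents D v l x) {g : Env k U}
    (hg : g * symCoeff D v (fun j => envD k (x j)) (D.star D.base) = 0) : g = 0 := by
  let S := LinearMap.rTensor Uᵐᵒᵖ hx.normalForm
  let ν : Uᵐᵒᵖ →ₗ[k] Uᵐᵒᵖ :=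
    LinearMap.mulRight k (op (x D.base)) + v (D.star D.base) • LinearMap.id
  -- Since c_{b*} = d_b - v_{b*}, the hypothesis equates multiplication by x_b on the left factor
  -- with an operator ν on the right factor.
  have h1 : LinearMap.rTensor Uᵐᵒᵖ (LinearMap.mulRight k (x D.base)) g =
      LinearMap.lTensor U ν g := by
    have : ∀ g : Env k U, g * symCoeff D v (fun j => envD k (x j)) (D.star D.base) =
        LinearMap.rTensor Uᵐᵒᵖ (LinearMap.mulRight k (x D.base)) g - LinearMap.lTensor U ν g := by
      intro g
      rw [symCoeff_star_base]
      induction g using TensorProduct.induction_on with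
      | zero => simp
      | tmul a b =>
        rw [mul_sub, tmul_mul_envD, mul_smul_comm, mul_one]
        simp [ν, sub_sub]
      | add f g hf hg => rw [add_mul, map_add, map_add, hf, hg]; abel
    rw [this] at hg
    exact sub_eq_zero.mp hg
  have h2 : LinearMap.rTensor Uᵐᵒᵖ (LinearMap.mulRight k (gen k D.base)) (S g) =
      LinearMap.lTensor _ ν (S g) := by
    have e1 : ∀ g, S (LinearMap.lTensor U ν g) = LinearMap.lTensor _ ν (S g) := fun g => by
      simp only [S, ← LinearMap.comp_apply, LinearMap.rTensor_comp_lTensor,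
        LinearMap.lTensor_comp_rTensor]
    rw [← e1, ← h1]
    simp only [S, ← LinearMap.comp_apply, ← LinearMap.rTensor_comp]
    congr 2
    ext a
    simp [hx.normalForm_mul_base]
  -- Deleting the appended letter x_b makes S g a fixed point of ∂_b ⊗ ν. This operator is locally
  -- nilpotent because ∂_b is, so S g = 0.
  have h3 : TensorProduct.map (rightDeriv D.base) ν (S g) = S g := by
    have e : LinearMap.rTensor Uᵐᵒᵖ (rightDeriv D.base)
        (LinearMap.rTensor Uᵐᵒᵖ (LinearMap.mulRight k (gen k D.base)) (S g)) = S g := by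
      rw [← LinearMap.comp_apply, ← LinearMap.rTensor_comp]
      have : rightDeriv D.base ∘ₗ LinearMap.mulRight k (gen k D.base) = LinearMap.id := by
        ext1 t
        simp [rightDeriv_mul_gen]
      rw [this, LinearMap.rTensor_id, LinearMap.id_apply]
    conv_rhs => rw [← e, h2]
    exact (LinearMap.congr_fun (LinearMap.rTensor_comp_lTensor ..) (S g)).symm
  obtain ⟨m, hm⟩ := map_locally_nilpotent _ ν (rightDeriv_locally_nilpotent (k := k) D.base) (S g)
  have h4 : ∀ m, (TensorProduct.map (rightDeriv D.base) ν ^ m) (S g) = S g := by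
    intro m
    induction m with
    | zero => rfl
    | succ m ih => rw [pow_succ, Module.End.mul_apply, h3, ih]
  rw [h4] at hm
  have h5 : LinearMap.rTensor Uᵐᵒᵖ (freeLift x).toLinearMap (S g) = g := by
    simp only [S]
    rw [← LinearMap.comp_apply, ← LinearMap.rTensor_comp]
    have : (freeLift x).toLinearMap ∘ₗ hx.normalForm = LinearMap.id := by
      ext1 t
      simp [hx.freeLift_normalForm]
    rw [this, LinearMap.rTensor_id, LinearMap.id_apply]
  rw [← h5, hm, map_zero]

end Bimodule

end KoszulPBW

namespace KoszulPBW

open MulOpposite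

/-! ### Self-duality of the resolution up to a twist -/

section Duality

variable {k : Type u} [Field k] {U : Type u} [Ring U] [Algebra k U]

/-- The anti-automorphism `a ⊗ b ↦ b ⊗ a` of the enveloping algebra. -/
def envSwap (k : Type u) [Field k] (U : Type u) [Ring U] [Algebra k U] : Env k U →ₗ[k] Env k U :=
  TensorProduct.map (opLinearEquiv k : U ≃ₗ[k] Uᵐᵒᵖ).symm.toLinearMap
    (opLinearEquiv k : U ≃ₗ[k] Uᵐᵒᵖ).toLinearMap ∘ₗ (TensorProduct.comm k U Uᵐᵒᵖ).toLinearMap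

theorem envSwap_tmul (a : U) (b : Uᵐᵒᵖ) : envSwap k U (a ⊗ₜ b) = unop b ⊗ₜ op a := rfl

theorem envSwap_envSwap (z : Env k U) : envSwap k U (envSwap k U z) = z := by
  induction z using TensorProduct.induction_on with
  | zero => simp
  | tmul a b => rfl
  | add y z hy hz => rw [map_add, map_add, hy, hz]

theorem envSwap_mul (y z : Env k U) : envSwap k U (y * z) = envSwap k U z * envSwap k U y := by
  induction y using TensorProduct.induction_on with
  | zero => rw [map_zero, zero_mul, mul_zero, map_zero]
  | tmul a b =>
    induction z using TensorProduct.induction_on with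
    | zero => rw [map_zero, zero_mul, mul_zero, map_zero]
    | tmul c d => simp [envSwap_tmul]
    | add z w hz hw => rw [mul_add, map_add, hz, hw, map_add, add_mul]
  | add y w hy hw => rw [add_mul, map_add, hy, hw, map_add, mul_add]

theorem envSwap_one : envSwap k U 1 = 1 := rfl

theorem envSwap_envD (a : U) : envSwap k U (envD k a) = -envD k a := by
  rw [envD_apply, map_sub, envSwap_tmul, envSwap_tmul, neg_sub]
  rfl

/-- The automorphism of the enveloping algebra induced by an automorphism on the left factor. -/
noncomputable def envTwist (σ : U ≃ₐ[k] U) : Env k U ≃ₐ[k] Env k U :=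
  Algebra.TensorProduct.congr σ AlgEquiv.refl

theorem envTwist_envD (σ : U ≃ₐ[k] U) {a : U} {c : k} (h : σ a = a + algebraMap k U c) :
    envTwist σ (envD k a) = envD k a + c • 1 := by
  rw [envD_apply, map_sub]
  simp only [envTwist, Algebra.TensorProduct.congr_apply, Algebra.TensorProduct.map_tmul]
  simp only [AlgEquiv.coe_toAlgHom, h, map_one, AlgEquiv.coe_refl, id_eq, TensorProduct.add_tmul,
    Algebra.algebraMap_eq_smul_one, Algebra.TensorProduct.one_def, TensorProduct.smul_tmul']
  abel

variable {n : ℕ} {x : Fin n → U} {D : Darboux k n} {v : Fin n → k} {l : k}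

/-- A translation changes the quadratic form only by terms that cancel under j ↔ j*; the linear part
changes by ∑ v_j t_j. -/
theorem SatisfiesRel.translate (hx : SatisfiesRel D v l x) (t : Fin n → k)
    (ht : ∑ j, v j * t j = 0) : SatisfiesRel D v l fun j => x j + algebraMap k U (t j) := by
  have h1 : ∑ j, D.sgn j • (t (D.star j) • x j + t j • x (D.star j) +
      (t j * t (D.star j)) • (1 : U)) = 0 := by
    refine D.sum_eq_zero _ fun j => ?_
    rw [D.star_star, D.sgn_star, neg_smul, mul_comm]
    abel_nf
  have h2 : ∑ j, v j • (t j • (1 : U)) = 0 := by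
    simp only [smul_smul, ← Finset.sum_smul, ht, zero_smul]
  rw [SatisfiesRel] at hx ⊢
  simp only [Algebra.algebraMap_eq_smul_one, smul_add, Finset.sum_add_distrib, h2, add_zero]
    at hx ⊢
  rw [← hx, ← sub_eq_zero, ← Finset.sum_sub_distrib, ← h1]
  refine Finset.sum_congr rfl fun j _ => ?_
  simp only [add_mul, mul_add, smul_mul_assoc, mul_smul_comm, one_mul, mul_one, smul_add, smul_smul]
  rw [mul_comm (t (D.star j)) (t j)]
  abel

theorem Presents.exists_translate (hx : Presents D v l x) (t : Fin n → k)
    (ht : ∑ j, v j * t j = 0) : ∃ σ : U ≃ₐ[k] U, ∀ j, σ (x j) = x j + algebraMap k U (t j) := by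
  obtain ⟨f, hf⟩ := hx.lift U _ (hx.rel.translate t ht)
  obtain ⟨g, hg⟩ := hx.lift U _ (hx.rel.translate (-t) (by simp [ht]))
  refine ⟨AlgEquiv.ofAlgHom f g ?_ ?_, hf⟩
  · refine AlgHom.ext_of_adjoin_eq_top hx.adjoin_eq_top ?_
    rintro _ ⟨j, rfl⟩
    simp [hf, hg]
  · refine AlgHom.ext_of_adjoin_eq_top hx.adjoin_eq_top ?_
    rintro _ ⟨j, rfl⟩
    simp [hf, hg]

/-- The bimodule resolution is self-dual up to a twist: an anti-automorphism of the enveloping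
algebra exchanges the coefficients of its two differentials. -/
theorem Presents.exists_duality (hx : Presents D v l x) :
    ∃ ρ : Env k U ≃ₗ[k] Env k U, (∀ y z, ρ (y * z) = ρ z * ρ y) ∧
      (∀ j, ρ (envD k (x j)) = (-D.sgn j) • symCoeff D v (fun j => envD k (x j)) (D.star j)) ∧
      ∀ j, ρ (symCoeff D v (fun j => envD k (x j)) j) = D.sgn j • envD k (x (D.star j)) := by
  -- Swapping alone sends d_j to -d_j, whereas -sgn_j c_{j*} = -d_j + sgn_j v_{j*}; the translation
  -- supplies the constant. It is admissible because the terms sgn_j v_j v_{j*} cancel in pairs.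
  obtain ⟨σ, hσ⟩ := hx.exists_translate (fun j => -(D.sgn j * v (D.star j))) (by
    refine D.sum_eq_zero _ fun j => ?_
    rw [D.star_star, D.sgn_star]
    ring)
  let τ : Env k U ≃ₗ[k] Env k U := LinearEquiv.ofInvolutive (envSwap k U) envSwap_envSwap
  have hτ : ∀ z, τ z = envSwap k U z := fun _ => rfl
  have hd : ∀ j, τ.trans (envTwist σ).toLinearEquiv (envD k (x j)) =
      -(envD k (x j)) + (D.sgn j * v (D.star j)) • 1 := by
    intro j
    rw [LinearEquiv.trans_apply, hτ, envSwap_envD, AlgEquiv.toLinearEquiv_apply, map_neg,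
      envTwist_envD σ (hσ j), neg_add, ← neg_smul (M := Env k U), neg_neg]
  refine ⟨τ.trans (envTwist σ).toLinearEquiv, ?_, ?_, ?_⟩
  · intro y z
    simp only [LinearEquiv.trans_apply, hτ, envSwap_mul, AlgEquiv.toLinearEquiv_apply, map_mul]
  · intro j
    rw [hd, symCoeff, D.star_star, D.sgn_star, smul_sub, smul_neg, smul_smul, smul_smul]
    rw [neg_mul_neg, D.sgn_mul_self]
    module
  · intro j
    have h1 : τ.trans (envTwist σ).toLinearEquiv 1 = 1 := by
      rw [LinearEquiv.trans_apply, hτ, envSwap_one, AlgEquiv.toLinearEquiv_apply, map_one]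
    rw [symCoeff, map_sub, map_neg, map_smul, map_smul, hd, h1, D.star_star, D.sgn_star, smul_add,
      smul_smul, neg_mul, mul_neg, ← mul_assoc, D.sgn_mul_self]
    module

/-- Exactness of the dual complex in degree zero. -/
theorem Presents.eq_zero_of_envD_mul (hx : Presents D v l x) {a : Env k U}
    (ha : envD k (x D.base) * a = 0) : a = 0 := by
  obtain ⟨ρ, hmul, hd, -⟩ := hx.exists_duality
  have h := congrArg ρ ha
  rw [hmul, hd, map_zero, D.sgn_base, mul_smul_comm] at h
  replace h := (smul_eq_zero_iff_right (neg_ne_zero.mpr one_ne_zero)).mp h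
  exact ρ.map_eq_zero_iff.mp (hx.eq_zero_of_mul_symCoeff h)

/-- Exactness of the dual complex in degree one. -/
theorem Presents.exists_eq_envD_mul (hx : Presents D v l x) {a : Fin n → Env k U}
    (ha : ∑ j, symCoeff D v (fun j => envD k (x j)) j * a j = 0) :
    ∃ g, ∀ j, a j = envD k (x j) * g := by
  obtain ⟨ρ, hmul, hd, hc⟩ := hx.exists_duality
  have h := congrArg ρ ha
  simp only [map_sum, hmul, hc, map_zero] at h
  rw [← D.sum_star] at h
  simp only [D.star_star, D.sgn_star, mul_smul_comm, ← smul_mul_assoc] at h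
  obtain ⟨g, hg⟩ := hx.exists_eq_mul_symCoeff h
  refine ⟨ρ.symm ((-1 : k) • g), fun j => ρ.injective ?_⟩
  have hj := hg (D.star j)
  rw [D.star_star] at hj
  rw [hmul, hd, ρ.apply_symm_apply, mul_smul_comm, smul_mul_assoc, ← hj, D.sgn_star, neg_neg, smul_smul,
    smul_smul, mul_neg_one, neg_neg, D.sgn_mul_self, one_smul]

end Duality

end KoszulPBW

namespace KoszulPBW

open CategoryTheory CategoryTheory.Limits
open scoped ZeroObject

/-! ### Projective resolutions of length two -/

section LengthTwo

universe w w'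

variable {C : Type w} [Category.{w'} C] [Abelian C] {P₀ P₁ P₂ S : C}

/-- The terms of a complex of length two. -/
noncomputable def lengthTwoX (P₀ P₁ P₂ : C) : ℕ → C
  | 0 => P₀
  | 1 => P₁
  | 2 => P₂
  | _ + 3 => 0

/-- The differentials of a complex of length two. -/
noncomputable def lengthTwoD (d₁ : P₁ ⟶ P₀) (d₂ : P₂ ⟶ P₁) :
    ∀ i, lengthTwoX P₀ P₁ P₂ (i + 1) ⟶ lengthTwoX P₀ P₁ P₂ i
  | 0 => d₁
  | 1 => d₂
  | _ + 2 => 0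

/-- The complex `0 ⟶ P₂ ⟶ P₁ ⟶ P₀`. -/
noncomputable def lengthTwo (d₁ : P₁ ⟶ P₀) (d₂ : P₂ ⟶ P₁) (h : d₂ ≫ d₁ = 0) : ChainComplex C ℕ :=
  ChainComplex.of (lengthTwoX P₀ P₁ P₂) (lengthTwoD d₁ d₂) fun i =>
    match i with
    | 0 => h
    | _ + 1 => zero_comp

variable {d₁ : P₁ ⟶ P₀} {d₂ : P₂ ⟶ P₁} (h : d₂ ≫ d₁ = 0) {ε : P₀ ⟶ S} (hε : d₁ ≫ ε = 0)

theorem lengthTwo_d (i : ℕ) : (lengthTwo d₁ d₂ h).d (i + 1) i = lengthTwoD d₁ d₂ i :=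
  ChainComplex.of_d _ _ _

theorem lengthTwo_exactAt (e₁ : (ShortComplex.mk d₂ d₁ h).Exact) [Mono d₂] (i : ℕ) :
    (lengthTwo d₁ d₂ h).ExactAt (i + 1) := by
  rw [HomologicalComplex.exactAt_iff' _ (i + 1 + 1) (i + 1) i (by simp) (by simp)]
  match i with
  | 0 =>
    refine (ShortComplex.exact_iff_of_iso (ShortComplex.isoMk (S₁ := ShortComplex.mk d₂ d₁ h)
      (Iso.refl P₂) (Iso.refl P₁) (Iso.refl P₀) ?_ ?_)).mp e₁
    · exact (Category.id_comp _).trans ((lengthTwo_d h 1).trans (Category.comp_id d₂).symm)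
    · exact (Category.id_comp _).trans ((lengthTwo_d h 0).trans (Category.comp_id d₁).symm)
  | 1 =>
    have hz : IsZero ((lengthTwo d₁ d₂ h).X 3) := isZero_zero C
    refine (ShortComplex.exact_iff_mono _ (hz.eq_of_src _ _)).mpr ?_
    have : Mono (lengthTwoD d₁ d₂ 1) := inferInstanceAs (Mono d₂)
    change Mono ((lengthTwo d₁ d₂ h).d 2 1)
    rw [lengthTwo_d]
    exact this
  | i + 2 => exact ShortComplex.exact_of_isZero_X₂ _ (isZero_zero C)

/-- The projective resolution of length two given by an exact sequence. -/
noncomputable def lengthTwoResolution [Projective P₀] [Projective P₁] [Projective P₂]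
    (e₀ : (ShortComplex.mk d₁ ε hε).Exact) (e₁ : (ShortComplex.mk d₂ d₁ h).Exact) [Mono d₂]
    [Epi ε] : ProjectiveResolution S where
  complex := lengthTwo d₁ d₂ h
  projective i := by
    match i with
    | 0 => exact inferInstanceAs (Projective P₀)
    | 1 => exact inferInstanceAs (Projective P₁)
    | 2 => exact inferInstanceAs (Projective P₂)
    | i + 3 => exact inferInstanceAs (Projective (0 : C))
  π := (ChainComplex.toSingle₀Equiv (lengthTwo d₁ d₂ h) S).symm
    ⟨ε, by rw [lengthTwo_d]; exact hε⟩
  quasiIso := ⟨fun i => by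
    cases i
    · rw [ChainComplex.quasiIsoAt₀_iff, ShortComplex.quasiIso_iff_of_zeros']
      · refine (ShortComplex.exact_and_epi_g_iff_of_iso ?_).2 ⟨e₀, ‹Epi ε›⟩
        refine ShortComplex.isoMk (Iso.refl _) (Iso.refl _) (Iso.refl _) ?_ ?_
        · exact (Category.id_comp _).trans ((lengthTwo_d h 0).symm.trans (Category.comp_id _).symm)
        · refine (Category.id_comp _).trans (Eq.trans ?_ (Category.comp_id _).symm)
          exact (ChainComplex.toSingle₀Equiv_symm_apply_f_zero (C := lengthTwo d₁ d₂ h) ε _).symm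
      all_goals rfl
    · rw [quasiIsoAt_iff_exactAt']
      · exact lengthTwo_exactAt h e₁ _
      · apply ChainComplex.exactAt_succ_single_obj⟩

end LengthTwo

/-! ### Ext with coefficients in the ring -/

section ExtModule

open CategoryTheory.Abelian

variable {E : Type u} [Ring E] {n : ℕ} {S : ModuleCat.{u} E}

/-- The sequence `0 → E → Eⁿ → E → S → 0`, with differentials given by the coefficients `c` and
`d`, is exact. -/
structure IsExactSeq (d c : Fin n → E) (ε : E →ₗ[E] S) : Prop where
  surjective : Function.Surjective ε
  ker_aug : ∀ f, ε f = 0 ↔ ∃ g : Fin n → E, f = ∑ j, g j * d j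
  exact : ∀ f : Fin n → E, ∑ j, f j * d j = 0 ↔ ∃ g, ∀ j, f j = g * c j
  injective : ∀ g, (∀ j, g * c j = 0) → g = 0

namespace IsExactSeq

variable {d c : Fin n → E} {ε : E →ₗ[E] S}

/-- The map `Eⁿ → E` with coefficients `d`. -/
def d₁ (d : Fin n → E) : ModuleCat.of E (Fin n → E) ⟶ ModuleCat.of E E :=
  ModuleCat.ofHom (Fintype.linearCombination E d)

/-- The map `E → Eⁿ` with coefficients `c`. -/
def d₂ (c : Fin n → E) : ModuleCat.of E E ⟶ ModuleCat.of E (Fin n → E) :=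
  ModuleCat.ofHom (LinearMap.toSpanSingleton E (Fin n → E) c)

variable (H : IsExactSeq d c ε)
include H

theorem d₂_d₁ : d₂ c ≫ d₁ d = 0 := by
  ext
  simpa [d₁, d₂, Fintype.linearCombination_apply] using
    (H.exact c).mpr ⟨1, fun j => (one_mul _).symm⟩

theorem d₁_aug : d₁ d ≫ ModuleCat.ofHom ε = 0 := by
  refine ModuleCat.hom_ext (LinearMap.ext fun f => ?_)
  exact (H.ker_aug _).mpr ⟨f, rfl⟩

/-- The free resolution of `S` given by the exact sequence. -/
noncomputable def resolution : ProjectiveResolution S :=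
  haveI : Projective (ModuleCat.of E E) := ModuleCat.projective_of_free (Module.Basis.singleton Unit E)
  haveI : Projective (ModuleCat.of E (Fin n → E)) :=
    ModuleCat.projective_of_free (Pi.basisFun E (Fin n))
  haveI : Mono (d₂ c) := (ModuleCat.mono_iff_injective _).mpr <| by
    refine (injective_iff_map_eq_zero (d₂ c).hom).mpr fun g hg => H.injective g fun j => ?_
    exact congrFun hg j
  haveI : Epi (ModuleCat.ofHom ε : ModuleCat.of E E ⟶ S) :=
    (ModuleCat.epi_iff_surjective _).mpr H.surjective
  lengthTwoResolution (d₁ := d₁ d) (d₂ := d₂ c) H.d₂_d₁ H.d₁_aug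
    (by
      rw [ShortComplex.moduleCat_exact_iff]
      intro f hf
      obtain ⟨g, rfl⟩ := (H.ker_aug f).mp hf
      exact ⟨g, by simp [d₁, Fintype.linearCombination_apply]⟩)
    (by
      rw [ShortComplex.moduleCat_exact_iff]
      intro f hf
      obtain ⟨g, hg⟩ := (H.exact f).mp (by
        simpa [d₁, Fintype.linearCombination_apply] using! hf)
      exact ⟨g, by ext j; simp [d₂, hg]⟩)

theorem resolution_d_one : H.resolution.complex.d 1 0 = d₁ d := lengthTwo_d H.d₂_d₁ 0

theorem resolution_d_two : H.resolution.complex.d 2 1 = d₂ c := lengthTwo_d H.d₂_d₁ 1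

theorem resolution_finite (i : ℕ) : Module.Finite E (H.resolution.complex.X i) := by
  match i with
  | 0 => exact inferInstanceAs (Module.Finite E E)
  | 1 => exact inferInstanceAs (Module.Finite E (Fin n → E))
  | 2 => exact inferInstanceAs (Module.Finite E E)
  | i + 3 =>
    have := ModuleCat.subsingleton_of_isZero (isZero_zero (ModuleCat.{u} E))
    exact inferInstanceAs (Module.Finite E (0 : ModuleCat.{u} E))

theorem resolution_isZero (i : ℕ) (hi : 2 < i) : IsZero (H.resolution.complex.X i) := by
  obtain ⟨i, rfl⟩ := Nat.exists_eq_add_of_le' hi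
  exact isZero_zero (ModuleCat.{u} E)

/-- Right multiplication by `a`, as a cochain of degree zero. -/
noncomputable def cochainZero (a : E) : H.resolution.complex.X 0 ⟶ ModuleCat.of E E :=
  (ModuleCat.ofHom (LinearMap.toSpanSingleton E E a) : ModuleCat.of E E ⟶ ModuleCat.of E E)

/-- The cochain of degree one with values `a`. -/
noncomputable def cochainOne (a : Fin n → E) : H.resolution.complex.X 1 ⟶ ModuleCat.of E E :=
  (ModuleCat.ofHom (Fintype.linearCombination E a) :
    ModuleCat.of E (Fin n → E) ⟶ ModuleCat.of E E)

/-- Right multiplication by `a`, as a cochain of degree two. -/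
noncomputable def cochainTwo (a : E) : H.resolution.complex.X 2 ⟶ ModuleCat.of E E :=
  (ModuleCat.ofHom (LinearMap.toSpanSingleton E E a) : ModuleCat.of E E ⟶ ModuleCat.of E E)

theorem cochainZero_surjective : Function.Surjective H.cochainZero := fun f =>
  ⟨(show ModuleCat.of E E ⟶ ModuleCat.of E E from f).hom (1 : E),
    ModuleCat.hom_ext (LinearMap.ext_ring (one_smul E _))⟩

theorem cochainTwo_surjective : Function.Surjective H.cochainTwo := fun f =>
  ⟨(show ModuleCat.of E E ⟶ ModuleCat.of E E from f).hom (1 : E),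
    ModuleCat.hom_ext (LinearMap.ext_ring (one_smul E _))⟩

theorem cochainOne_surjective : Function.Surjective H.cochainOne := fun f => by
  let f' : (Fin n → E) →ₗ[E] E :=
    (show ModuleCat.of E (Fin n → E) ⟶ ModuleCat.of E E from f).hom
  refine ⟨fun j => f' (Pi.single j 1), ModuleCat.hom_ext ?_⟩
  change Fintype.linearCombination E _ = f'
  refine LinearMap.pi_ext' fun j => LinearMap.ext_ring ?_
  simp [Fintype.linearCombination_apply_single]

/-- With `d_two_comp`, this identifies the Hom complex into E with the complex E → Eⁿ → E given by
left multiplication by d and then by c. -/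
theorem d_one_comp (a : E) : H.resolution.complex.d 1 0 ≫ H.cochainZero a =
    H.cochainOne fun j => d j * a := by
  rw [resolution_d_one]
  refine ModuleCat.hom_ext (LinearMap.ext fun f => ?_)
  change (∑ j, f j • d j) • a = ∑ j, f j • (d j * a)
  simp [Finset.sum_mul, mul_assoc]

theorem d_two_comp (a : Fin n → E) : H.resolution.complex.d 2 1 ≫ H.cochainOne a =
    H.cochainTwo (∑ j, c j * a j) := by
  rw [resolution_d_two]
  refine ModuleCat.hom_ext (LinearMap.ext_ring ?_)
  change ∑ j, ((1 : E) • c) j • a j = (1 : E) • ∑ j, c j * a j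
  simp

theorem cochainOne_injective : Function.Injective H.cochainOne := fun a b hab => by
  have h : Fintype.linearCombination E a = Fintype.linearCombination E b :=
    congrArg ModuleCat.Hom.hom hab
  ext j
  simpa [Fintype.linearCombination_apply_single] using LinearMap.congr_fun h (Pi.single j 1)

theorem cochainTwo_injective : Function.Injective H.cochainTwo := fun a b hab => by
  have h : LinearMap.toSpanSingleton E E a = LinearMap.toSpanSingleton E E b :=
    congrArg ModuleCat.Hom.hom hab
  simpa using LinearMap.congr_fun h 1

theorem cochainZero_zero : H.cochainZero 0 = 0 :=
  congrArg ModuleCat.ofHom (LinearMap.toSpanSingleton_zero ..)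

theorem cochainOne_zero : H.cochainOne 0 = 0 := by
  refine ModuleCat.hom_ext (LinearMap.ext fun f => ?_)
  change ∑ j, f j • (0 : E) = 0
  simp

theorem cochainTwo_zero : H.cochainTwo 0 = 0 :=
  congrArg ModuleCat.ofHom (LinearMap.toSpanSingleton_zero ..)

theorem cochainTwo_add (a b : E) :
    H.cochainTwo (a + b) = H.cochainTwo a + H.cochainTwo b :=
  congrArg ModuleCat.ofHom (LinearMap.toSpanSingleton_add ..)

theorem cochainTwo_comp (a r : E) :
    H.cochainTwo a ≫ ModuleCat.ofHom (LinearMap.toSpanSingleton E E r) = H.cochainTwo (a * r) := by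
  refine ModuleCat.hom_ext (LinearMap.ext_ring ?_)
  change ((1 : E) • a) • r = (1 : E) • (a * r)
  simp

theorem subsingleton_ext_zero (h : ∀ a, (∀ j, d j * a = 0) → a = 0) :
    Subsingleton (Ext S (ModuleCat.of E E) 0) := by
  refine subsingleton_of_forall_eq 0 fun ξ => ?_
  obtain ⟨f, hf, rfl⟩ := H.resolution.extMk_surjective ξ 1 rfl
  obtain ⟨a, rfl⟩ := H.cochainZero_surjective f
  have ha := hf
  rw [d_one_comp, ← cochainOne_zero] at ha
  obtain rfl := h a (congrFun (H.cochainOne_injective ha))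
  simp only [cochainZero_zero]
  exact H.resolution.extMk_zero _ _

theorem subsingleton_ext_one (h : ∀ a : Fin n → E, ∑ j, c j * a j = 0 → ∃ g, ∀ j, a j = d j * g) :
    Subsingleton (Ext S (ModuleCat.of E E) 1) := by
  refine subsingleton_of_forall_eq 0 fun ξ => ?_
  obtain ⟨f, hf, rfl⟩ := H.resolution.extMk_surjective ξ 2 rfl
  rw [H.resolution.extMk_eq_zero_iff _ _ _ _ 0 rfl]
  obtain ⟨a, rfl⟩ := H.cochainOne_surjective f
  rw [d_two_comp, ← cochainTwo_zero] at hf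
  obtain ⟨g, hg⟩ := h a (H.cochainTwo_injective hf)
  exact ⟨H.cochainZero g, by rw [d_one_comp, funext hg]⟩

theorem subsingleton_ext_of_two_lt (i : ℕ) (hi : 2 < i) :
    Subsingleton (Ext S (ModuleCat.of E E) i) := by
  refine subsingleton_of_forall_eq 0 fun ξ => ?_
  obtain ⟨f, hf, rfl⟩ := H.resolution.extMk_surjective ξ (i + 1) rfl
  obtain rfl : f = 0 := (H.resolution_isZero i hi).eq_of_src _ _
  exact H.resolution.extMk_zero _ _

/-- The class in `Ext²` of the cocycle given by right multiplication by `a`. -/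
noncomputable def extClass (a : E) : Ext S (ModuleCat.of E E) 2 :=
  H.resolution.extMk (H.cochainTwo a) 3 rfl ((H.resolution_isZero 3 (by omega)).eq_of_src _ _)

theorem extClass_add (a b : E) : H.extClass (a + b) = H.extClass a + H.extClass b := by
  simp only [extClass, ProjectiveResolution.add_extMk, cochainTwo_add]

theorem extClass_surjective : Function.Surjective H.extClass := by
  intro ξ
  obtain ⟨f, hf, rfl⟩ := H.resolution.extMk_surjective ξ 3 rfl
  obtain ⟨a, rfl⟩ := H.cochainTwo_surjective f
  exact ⟨a, rfl⟩

theorem extClass_comp (a r : E) :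
    (H.extClass a).comp (Ext.mk₀ (ModuleCat.ofHom (LinearMap.toSpanSingleton E E r)))
      (add_zero 2) = H.extClass (a * r) := by
  simp only [extClass, ProjectiveResolution.extMk_comp_mk₀, cochainTwo_comp]

/-- The coboundaries in degree two are the right ideal generated by the c_j and every element is a
cocycle, so Ext² = E / ∑ c_j E. -/
theorem extClass_eq_zero_iff (a : E) :
    H.extClass a = 0 ↔ ∃ g : Fin n → E, a = ∑ j, c j * g j := by
  rw [extClass, H.resolution.extMk_eq_zero_iff _ _ _ _ 1 rfl]
  constructor
  · rintro ⟨f, hf⟩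
    obtain ⟨g, rfl⟩ := H.cochainOne_surjective f
    rw [d_two_comp] at hf
    exact ⟨g, (H.cochainTwo_injective hf).symm⟩
  · rintro ⟨g, rfl⟩
    exact ⟨H.cochainOne g, H.d_two_comp g⟩

end IsExactSeq

end ExtModule

end KoszulPBW

namespace KoszulPBW

open MulOpposite CategoryTheory CategoryTheory.Abelian

/-! ### Hochschild cohomology and the Calabi-Yau criterion -/

section CalabiYauCriterion

variable {k : Type u} [Field k] {U : Type u} [Ring U] [Algebra k U] {n : ℕ} {x : Fin n → U}
  {D : Darboux k n} {v : Fin n → k} {l : k}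

theorem Presents.isExactSeq (hx : Presents D v l x) :
    IsExactSeq (fun j => envD k (x j)) (symCoeff D v fun j => envD k (x j)) (envAug k U) where
  surjective := envAug_surjective
  ker_aug f := by
    refine ⟨ker_envAug hx.adjoin_eq_top, ?_⟩
    rintro ⟨g, rfl⟩
    rw [map_sum]
    refine Finset.sum_eq_zero fun j _ => ?_
    rw [← smul_eq_mul, map_smul, envAug_envD, smul_zero]
  exact f := by
    refine ⟨hx.exists_eq_mul_symCoeff, ?_⟩
    rintro ⟨g, hg⟩
    simp only [hg, mul_assoc, ← Finset.mul_sum]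
    rw [sum_symCoeff_mul hx.rel.sum_envD, mul_zero]
  injective g hg := hx.eq_zero_of_mul_symCoeff (hg _)

theorem Presents.hasFiniteBimodResolution (hx : Presents D v l x) :
    HasFiniteBimodResolution k U :=
  ⟨hx.isExactSeq.resolution, hx.isExactSeq.resolution_finite, 2, hx.isExactSeq.resolution_isZero⟩

theorem Presents.subsingleton_ext (hx : Presents D v l x) (i : ℕ) (hi : i ≠ 2) :
    Subsingleton (HH k U (outerBimod k U) i) := by
  match i, hi with
  | 0, _ => exact hx.isExactSeq.subsingleton_ext_zero fun a ha => hx.eq_zero_of_envD_mul (ha _)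
  | 1, _ => exact hx.isExactSeq.subsingleton_ext_one fun a ha => hx.exists_eq_envD_mul ha
  | i + 3, _ => exact hx.isExactSeq.subsingleton_ext_of_two_lt _ (by omega)

theorem selfRightAct_eq (y : U) (r : Env k U) :
    selfRightAct k y r = AlgHom.mulLeftRight k U (envSwap k U r) y := rfl

theorem selfRightAct_mul (y : U) (r s : Env k U) :
    selfRightAct k y (r * s) = selfRightAct k (selfRightAct k y r) s := by
  simp only [selfRightAct_eq, envSwap_mul, map_mul, Module.End.mul_apply]

theorem selfRightAct_add (y : U) (r s : Env k U) :
    selfRightAct k y (r + s) = selfRightAct k y r + selfRightAct k y s := by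
  simp only [selfRightAct_eq, map_add, LinearMap.add_apply]

theorem selfRightAct_sub (y : U) (r s : Env k U) :
    selfRightAct k y (r - s) = selfRightAct k y r - selfRightAct k y s := by
  simp only [selfRightAct_eq, map_sub, LinearMap.sub_apply]

theorem selfRightAct_smul (y : U) (c : k) (r : Env k U) :
    selfRightAct k y (c • r) = c • selfRightAct k y r := by
  simp only [selfRightAct_eq, map_smul, LinearMap.smul_apply]

theorem selfRightAct_one (y : U) : selfRightAct k y 1 = y := by
  rw [selfRightAct_eq, envSwap_one, map_one, Module.End.one_apply]

theorem selfRightAct_envD (y a : U) : selfRightAct k y (envD k a) = y * a - a * y := by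
  rw [envD_apply, selfRightAct_sub, selfRightAct_tmul, selfRightAct_tmul]
  simp

/-- This turns the annihilator of 1 in the right module U into the swap of the augmentation kernel,
whose generators are known from `ker_envAug`. -/
theorem selfRightAct_one_left (r : Env k U) :
    selfRightAct k 1 r = (show U from envAug k U (envSwap k U r)) := by
  induction r using TensorProduct.induction_on with
  | zero => simp only [selfRightAct_eq, map_zero, LinearMap.zero_apply]; rfl
  | tmul a b => rw [selfRightAct_tmul, envSwap_tmul, envAug_tmul, mul_one, unop_op]
  | add y z hy hz => rw [selfRightAct_add, hy, hz, map_add, map_add]; rfl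

/-- The classes in `HH²(U, U ⊗ U)` of the cocycles given by the elements of the enveloping
algebra. -/
noncomputable def Presents.extClass (hx : Presents D v l x) :
    Env k U →+ HH k U (outerBimod k U) 2 :=
  AddMonoidHom.mk' hx.isExactSeq.extClass hx.isExactSeq.extClass_add

theorem Presents.extClass_surjective (hx : Presents D v l x) :
    Function.Surjective hx.extClass := hx.isExactSeq.extClass_surjective

theorem Presents.extClass_eq_zero_iff (hx : Presents D v l x) (a : Env k U) : hx.extClass a = 0 ↔
    ∃ g : Fin n → Env k U, a = ∑ j, symCoeff D v (fun j => envD k (x j)) j * g j :=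
  hx.isExactSeq.extClass_eq_zero_iff a

theorem Presents.extRightAct_extClass (hx : Presents D v l x) (a r : Env k U) :
    extRightAct k (hx.extClass a) r = hx.extClass (a * r) :=
  hx.isExactSeq.extClass_comp a r

/-- For v = 0 the elements c_j and d_{j*} differ by a sign, so Ext² = U^e / ∑ d_j U^e. This right
ideal is the annihilator of 1 ∈ U, and acting on 1 gives the isomorphism with U. -/
theorem Presents.isCalabiYau_of_eq_zero (hx : Presents D 0 l x) : IsCalabiYau k U 2 := by
  refine ⟨by norm_num, hx.hasFiniteBimodResolution, hx.subsingleton_ext, ?_⟩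
  let θ : Env k U →+ U := AddMonoidHom.mk' (selfRightAct k 1) (selfRightAct_add 1)
  have hθ : Function.Surjective θ := fun a => ⟨a ⊗ₜ 1, by simp [θ, selfRightAct_tmul]⟩
  have hc : ∀ j, symCoeff D 0 (fun j => envD k (x j)) j =
      (-D.sgn j) • envD k (x (D.star j)) := by
    intro j
    rw [symCoeff_eq, Pi.zero_apply, zero_smul, sub_zero]
  have hker : hx.extClass.ker = θ.ker := by
    ext a
    rw [AddMonoidHom.mem_ker, AddMonoidHom.mem_ker]
    change _ ↔ selfRightAct k 1 a = 0
    rw [hx.extClass_eq_zero_iff]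
    constructor
    · rintro ⟨g, rfl⟩
      change θ _ = 0
      rw [map_sum]
      refine Finset.sum_eq_zero fun j _ => ?_
      change selfRightAct k 1 _ = 0
      rw [selfRightAct_mul, hc, selfRightAct_smul, selfRightAct_envD, one_mul, mul_one, sub_self,
        smul_zero, selfRightAct_eq, map_zero]
    · intro h
      rw [selfRightAct_one_left] at h
      obtain ⟨g, hg⟩ := ker_envAug hx.adjoin_eq_top h
      -- The factor -1 comes from the swap of d_{j*}, and -sgn_j is its own inverse in c_j = -sgn_j
      -- d_{j*}.
      refine ⟨fun j => (-D.sgn j) • (-1 : k) • envSwap k U (g (D.star j)), ?_⟩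
      rw [← envSwap_envSwap a, hg, map_sum, ← D.sum_star]
      refine Finset.sum_congr rfl fun j _ => ?_
      rw [envSwap_mul, envSwap_envD, hc, smul_mul_assoc, mul_smul_comm, mul_smul_comm, smul_smul,
        neg_mul_neg, D.sgn_mul_self, one_smul, ← neg_one_smul k, smul_mul_assoc]
  let e : Ext (selfBimod k U) (outerBimod k U) 2 ≃+ U :=
    ((QuotientAddGroup.quotientKerEquivOfSurjective hx.extClass hx.extClass_surjective).symm.trans
      (QuotientAddGroup.quotientAddEquivOfEq hker)).trans
      (QuotientAddGroup.quotientKerEquivOfSurjective θ hθ)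
  have he : ∀ a, e (hx.extClass a) = selfRightAct k 1 a := by
    intro a
    have : (QuotientAddGroup.quotientKerEquivOfSurjective hx.extClass hx.extClass_surjective).symm (hx.extClass a) =
        QuotientAddGroup.mk a := by
      rw [AddEquiv.symm_apply_eq]
      rfl
    simp only [e, AddEquiv.trans_apply, this]
    rfl
  refine ⟨e, fun ξ r => ?_⟩
  obtain ⟨a, rfl⟩ := hx.extClass_surjective ξ
  rw [hx.extRightAct_extClass, he, he, selfRightAct_mul]

theorem Presents.exists_character (hx : Presents D v l x) (hv : v ≠ 0) :
    Nonempty (U →ₐ[k] k) := by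
  obtain ⟨i, hi⟩ := Function.ne_iff.mp hv
  rw [Pi.zero_apply] at hi
  -- In a commutative algebra the quadratic form vanishes, so a character is a solution of ∑ v_j x_j
  -- + λ = 0.
  obtain ⟨f, -⟩ := hx.lift k (Pi.single i (-l / v i)) (by
    rw [SatisfiesRel, D.sum_eq_zero]
    · simp [Pi.single_apply, mul_div_cancel₀ _ hi]
    · intro j
      rw [D.star_star, D.sgn_star, neg_smul, mul_comm, add_neg_cancel])
  exact ⟨f⟩

theorem character_selfRightAct (χ : U →ₐ[k] k) (y : U) (hy : χ y = 0) (r : Env k U) :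
    χ (selfRightAct k y r) = 0 := by
  induction r using TensorProduct.induction_on with
  | zero => simp only [selfRightAct_eq, map_zero, LinearMap.zero_apply]
  | tmul a b => simp [selfRightAct_tmul, hy]
  | add r s hr hs => rw [selfRightAct_add, map_add, hr, hs, add_zero]

/-- A character kills commutators. Applied to the relations u c_j = 0 for the image u of the class
of 1, it leaves v_j χ(u) = 0. -/
theorem Presents.eq_zero_of_isCalabiYau (hx : Presents D v l x) (h : IsCalabiYau k U 2) :
    v = 0 := by
  by_contra hv
  obtain ⟨χ⟩ := hx.exists_character hv
  obtain ⟨-, -, -, e, he⟩ := h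
  -- The image of the class of 1 generates U as a right module; were it in the kernel of χ, so would
  -- be 1.
  have hu : χ (e (hx.extClass 1)) ≠ 0 := by
    intro h0
    obtain ⟨a, ha⟩ := hx.extClass_surjective (e.symm 1)
    have h1 : e (hx.extClass a) = selfRightAct k (e (hx.extClass 1)) a := by
      rw [← he, hx.extRightAct_extClass, one_mul]
    have h2 := character_selfRightAct χ _ h0 a
    rw [← h1, ha, e.apply_symm_apply, map_one] at h2
    exact one_ne_zero h2
  refine hv (funext fun j => ?_)
  have h1 : hx.extClass (symCoeff D v (fun j => envD k (x j)) j) = 0 :=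
    (hx.extClass_eq_zero_iff _).mpr ⟨Pi.single j 1, by simp [Pi.single_apply]⟩
  have h2 := he (hx.extClass 1) (symCoeff D v (fun j => envD k (x j)) j)
  rw [hx.extRightAct_extClass, one_mul, h1, map_zero, symCoeff_eq, selfRightAct_sub,
    selfRightAct_smul, selfRightAct_smul, selfRightAct_envD, selfRightAct_one] at h2
  have h3 := congrArg χ h2
  rw [map_zero, map_sub, map_smul, map_smul, map_sub, map_mul, map_mul, mul_comm, sub_self,
    smul_zero, zero_sub, eq_comm, neg_eq_zero] at h3
  exact (smul_eq_zero.mp h3).resolve_right hu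

end CalabiYauCriterion

end KoszulPBW

namespace KoszulPBW

/-! ### The quotient algebra and the PBW deformation -/

section Quotient

variable {k : Type u} [Field k] {n : ℕ} (D : Darboux k n) (v : Fin n → k) (l : k)

/-- The quadratic form `∑ j, sgn j • x_j x_{star j}`. -/
def Darboux.form : TensorAlgebra k (Fin n → k) := ∑ j, D.sgn j • (gen k j * gen k (D.star j))

/-- The line spanned by the symplectic relation. -/
def Darboux.relLine : Submodule k (TensorAlgebra k (Fin n → k)) :=
  Submodule.span k {D.form - TensorAlgebra.ι k v - algebraMap k _ l}

/-- The class of `x_j` in the quotient algebra. -/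
def quotGen (P : Submodule k (TensorAlgebra k (Fin n → k))) (j : Fin n) : QuotAlg P :=
  qmk P (gen k j)

theorem freeLift_quotGen (P : Submodule k (TensorAlgebra k (Fin n → k)))
    (t : TensorAlgebra k (Fin n → k)) : freeLift (quotGen P) t = qmk P t := by
  have : freeLift (quotGen P) = qmk P := by
    refine AlgHom.ext_of_adjoin_eq_top adjoin_gen ?_
    rintro _ ⟨j, rfl⟩
    rw [freeLift_gen, quotGen]
  rw [this]

theorem qmk_eq_zero_of_mem {V : Type u} [AddCommGroup V] [Module k V]
    {P : Submodule k (TensorAlgebra k V)} {t : TensorAlgebra k V} (ht : t ∈ P) : qmk P t = 0 :=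
  Ideal.Quotient.eq_zero_iff_mem.mpr
    (TwoSidedIdeal.mem_asIdeal.mpr (TwoSidedIdeal.subset_span ht))

theorem presents_quotGen : Presents D v l (quotGen (D.relLine v l)) where
  rel := by
    have h := qmk_eq_zero_of_mem (P := D.relLine v l) (Submodule.mem_span_singleton_self _)
    rw [map_sub, map_sub, Darboux.form, ι_eq_sum, AlgHom.commutes, sub_sub, sub_eq_zero] at h
    simp only [map_sum, map_smul, map_mul] at h
    exact h
  adjoin_eq_top := by
    have h := congrArg (Subalgebra.map (qmk (D.relLine v l))) (adjoin_gen (k := k) (n := n))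
    rw [AlgHom.map_adjoin, ← Set.range_comp, Algebra.map_top,
      (AlgHom.range_eq_top _).mpr (Ideal.Quotient.mkₐ_surjective k _)] at h
    exact h
  lift B _ _ y hy := by
    have hle : TwoSidedIdeal.span (D.relLine v l : Set (TensorAlgebra k (Fin n → k))) ≤
        TwoSidedIdeal.ker (freeLift y) := by
      rw [TwoSidedIdeal.span_le]
      have : D.relLine v l ≤ LinearMap.ker (freeLift y).toLinearMap := by
        rw [Darboux.relLine, Submodule.span_singleton_le_iff_mem, LinearMap.mem_ker,
          AlgHom.toLinearMap_apply, map_sub, map_sub, Darboux.form, ι_eq_sum, AlgHom.commutes,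
          sub_sub, sub_eq_zero]
        rw [SatisfiesRel] at hy
        simpa only [map_sum, map_smul, map_mul, freeLift_gen] using hy
      exact fun t ht => (TwoSidedIdeal.mem_ker _).mpr (this ht)
    refine ⟨Ideal.Quotient.liftₐ _ (freeLift y) fun t ht => ?_, fun j => ?_⟩
    · exact (TwoSidedIdeal.mem_ker _).mp (hle (TwoSidedIdeal.mem_asIdeal.mp ht))
    · exact freeLift_gen y j

theorem Darboux.form_mem_tpow : D.form ∈ tpow k (Fin n → k) 2 :=
  Submodule.sum_mem _ fun _ _ => Submodule.smul_mem _ _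
    (mul_mem_tpow (i := 1) (j := 1) (gen_mem_tpow _) (gen_mem_tpow _))

theorem lower_mem_tfilt :
    TensorAlgebra.ι k v + algebraMap k _ l ∈ tfilt k (Fin n → k) 1 := by
  refine Submodule.add_mem _ (tpow_le_tfilt 1 ?_) (tfilt_mono (Nat.zero_le 1) (tpow_le_tfilt 0 ?_))
  · rw [tpow, pow_one]; exact LinearMap.mem_range_self _ _
  · rw [Algebra.algebraMap_eq_smul_one]; exact Submodule.smul_mem _ _ one_mem_tpow

theorem Darboux.map_tproj_relLine : (D.relLine v l).map (tproj k _ 2) = D.relLine 0 0 := by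
  rw [Darboux.relLine, Darboux.relLine, Submodule.map_span, Set.image_singleton, sub_sub, map_sub,
    tproj_of_mem D.form_mem_tpow, tproj_of_mem_tfilt (lower_mem_tfilt v l)]
  simp

theorem Darboux.relLine_zero : D.relLine 0 0 = Submodule.span k {D.form} := by
  simp [Darboux.relLine]

theorem Darboux.relLine_le_tfilt : D.relLine v l ≤ tfilt k (Fin n → k) 2 := by
  rw [Darboux.relLine, Submodule.span_singleton_le_iff_mem, sub_sub]
  exact Submodule.sub_mem _ (tpow_le_tfilt 2 D.form_mem_tpow)
    (tfilt_mono one_le_two (lower_mem_tfilt v l))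

theorem Darboux.relLine_zero_le_tpow : D.relLine 0 0 ≤ tpow k (Fin n → k) 2 := by
  rw [D.relLine_zero, Submodule.span_singleton_le_iff_mem]
  exact D.form_mem_tpow

theorem rightDeriv_form (j : Fin n) :
    rightDeriv j D.form = -(D.sgn j • gen k (D.star j)) := by
  rw [Darboux.form, map_sum, ← D.sum_star]
  simp only [D.star_star, D.sgn_star, neg_smul, map_neg, map_smul, rightDeriv_mul_gen, smul_ite, smul_zero,
    Finset.sum_ite_eq', Finset.mem_univ, if_true, Finset.sum_neg_distrib]

/-- A linear form on `T(V)` with value `1` on the quadratic form. -/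
theorem Darboux.exists_functional : ∃ f : TensorAlgebra k (Fin n → k) →ₗ[k] k, f D.form = 1 := by
  -- Deleting x_b from the form leaves -x_{b*}, and deleting x_{b*} then leaves -1.
  refine ⟨-(TensorAlgebra.algebraMapInv.toLinearMap ∘ₗ rightDeriv (D.star D.base) ∘ₗ
    rightDeriv D.base), ?_⟩
  have h := rightDeriv_mul_gen (k := k) (D.star D.base) (D.star D.base) 1
  rw [one_mul, if_pos rfl] at h
  simp [rightDeriv_form, D.sgn_base, h]

theorem exists_linearEquiv_of_ker_eq {X Y Z : Type*} [AddCommGroup X] [Module k X]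
    [AddCommGroup Y] [Module k Y] [AddCommGroup Z] [Module k Z] (f : X →ₗ[k] Y) (g : X →ₗ[k] Z)
    (hf : Function.Surjective f) (hg : Function.Surjective g)
    (h : LinearMap.ker f = LinearMap.ker g) : ∃ p : Y ≃ₗ[k] Z, ∀ t, p (f t) = g t := by
  refine ⟨(f.quotKerEquivOfSurjective hf).symm.trans ((Submodule.quotEquivOfEq _ _ h).trans
    (g.quotKerEquivOfSurjective hg)), fun t => ?_⟩
  have : (f.quotKerEquivOfSurjective hf).symm (f t) = Submodule.Quotient.mk t := by
    rw [LinearEquiv.symm_apply_eq]; rfl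
  simp only [LinearEquiv.trans_apply, this]
  rfl

theorem tfilt_eq_sup {V : Type u} [AddCommGroup V] [Module k V] (m : ℕ) :
    tfilt k V m ≤ tpow k V m ⊔ tfiltPred k V m := by
  refine tfilt_induction fun i hi => ?_
  rcases hi.lt_or_eq with h | rfl
  · obtain ⟨m, rfl⟩ := Nat.exists_eq_succ_of_ne_zero (by omega : m ≠ 0)
    exact ((tpow_le_tfilt i).trans (tfilt_mono (by omega))).trans le_sup_right
  · exact le_sup_left

theorem ufiltPred_eq_map {V : Type u} [AddCommGroup V] [Module k V]
    (P : Submodule k (TensorAlgebra k V)) (m : ℕ) :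
    ufiltPred P m = (tfiltPred k V m).map (qmk P).toLinearMap := by
  cases m with
  | zero => exact (Submodule.map_bot _).symm
  | succ m => rfl

theorem toAcomp_surjective {V : Type u} [AddCommGroup V] [Module k V]
    (R : Submodule k (TensorAlgebra k V)) (m : ℕ) : Function.Surjective (toAcomp R m) := by
  rintro ⟨_, t, ht, rfl⟩
  exact ⟨⟨t, ht⟩, rfl⟩

theorem toGr_eq_zero_iff {V : Type u} [AddCommGroup V] [Module k V]
    (P : Submodule k (TensorAlgebra k V)) (m : ℕ) (t : tpow k V m) :
    toGr P m t = 0 ↔ qmk P t ∈ ufiltPred P m := by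
  rw [toGr, LinearMap.comp_apply, Submodule.mkQ_apply, Submodule.Quotient.mk_eq_zero]
  exact Iff.rfl

theorem toGr_surjective {V : Type u} [AddCommGroup V] [Module k V]
    (P : Submodule k (TensorAlgebra k V)) (m : ℕ) : Function.Surjective (toGr P m) := by
  intro z
  obtain ⟨⟨_, t, ht, rfl⟩, rfl⟩ := Submodule.Quotient.mk_surjective _ z
  obtain ⟨a, ha, b, hb, rfl⟩ := Submodule.mem_sup.mp (tfilt_eq_sup m ht)
  refine ⟨⟨a, ha⟩, (Submodule.Quotient.eq _).mpr ?_⟩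
  change qmk P a - qmk P (a + b) ∈ ufiltPred P m
  rw [ufiltPred_eq_map, ← neg_mem_iff]
  exact ⟨b, hb, by simp⟩

/-- The PBW theorem for the symplectic relation. -/
theorem Darboux.isPBWDeformation : IsPBWDeformation 2 (D.relLine 0 0) (D.relLine v l) := by
  refine ⟨D.relLine_zero_le_tpow, ?_, ?_⟩
  · obtain ⟨f, hf⟩ := D.exists_functional
    -- The functional takes the value 1 on the form, so φ sends the form to v + λ.
    refine ⟨(f.smulRight (TensorAlgebra.ι k v + algebraMap k _ l)).domRestrict _,
      fun r => Submodule.smul_mem _ _ (lower_mem_tfilt v l), ?_⟩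
    have h : (D.relLine 0 0).subtype - (f.smulRight (TensorAlgebra.ι k v +
        algebraMap k _ l)).domRestrict (D.relLine 0 0) = (LinearMap.id - f.smulRight
          (TensorAlgebra.ι k v + algebraMap k _ l)) ∘ₗ (D.relLine 0 0).subtype := rfl
    rw [h, LinearMap.range_comp, Submodule.range_subtype, D.relLine_zero, Submodule.map_span,
      Set.image_singleton, Darboux.relLine, sub_sub]
    simp [hf]
  · have h : ∀ m, ∃ p : acomp (D.relLine 0 0) m ≃ₗ[k] Gr (D.relLine v l) m,
        ∀ t, p (toAcomp _ m t) = toGr _ m t := by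
      intro m
      -- Both A_m and gr_m(U) are quotients of V^{⊗ m}; the normal form comparison says that the two
      -- kernels coincide.
      refine exists_linearEquiv_of_ker_eq _ _ (toAcomp_surjective _ m) (toGr_surjective _ m) ?_
      ext t
      have key := (presents_quotGen D 0 0).freeLift_eq_zero_iff (presents_quotGen D v l) m t.2
      rw [LinearMap.mem_ker, LinearMap.mem_ker, toGr_eq_zero_iff, ufiltPred_eq_map]
      have e : (freeLift (quotGen (D.relLine v l))).toLinearMap =
          (qmk (D.relLine v l)).toLinearMap :=
        LinearMap.ext (freeLift_quotGen _)
      rw [freeLift_quotGen, freeLift_quotGen, e] at key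
      rw [← key]
      exact Subtype.ext_iff
    choose p hp using h
    exact ⟨p, hp⟩

end Quotient

end KoszulPBW

namespace KoszulPBW

/-! ### The Koszul complex of the homogeneous algebra -/

section KoszulComplex

variable {k : Type u} [Field k]

theorem toTensorAlgebra_injective {V : Type u} [AddCommGroup V] [Module k V] (m : ℕ) :
    Function.Injective
      (TensorPower.toTensorAlgebra : (⨂[k]^m V) →ₗ[k] TensorAlgebra k V) := by
  intro a b h
  have key : ∀ w : ⨂[k]^m V, TensorAlgebra.ofDirectSum
      (DirectSum.of (fun m => ⨂[k]^m V) m w) = TensorPower.toTensorAlgebra w :=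
    fun w => DirectSum.toAddMonoid_of _ _ _
  rw [← key, ← key] at h
  exact DirectSum.of_injective m (TensorAlgebra.equivDirectSum.symm.injective h)

variable {n : ℕ} (D : Darboux k n)

theorem mul_rightDeriv (j : Fin n) (p : TensorAlgebra k (Fin n → k)) :
    rightDeriv j (p * D.form) = -(D.sgn j • (p * gen k (D.star j))) := by
  rw [Darboux.form, Finset.mul_sum, map_sum, ← D.sum_star]
  simp only [D.star_star, D.sgn_star, neg_smul, mul_neg, mul_smul_comm, map_neg, map_smul,
    ← mul_assoc, rightDeriv_mul_gen, smul_ite, smul_zero, Finset.sum_ite_eq', Finset.mem_univ,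
    if_true, Finset.sum_neg_distrib]

theorem eq_zero_of_mul_gen_eq_zero {p : TensorAlgebra k (Fin n → k)} {j : Fin n}
    (h : p * gen k j = 0) : p = 0 := by
  have h1 := rightDeriv_mul_gen j j p
  rwa [h, map_zero, if_pos rfl, eq_comm] at h1

/-- Let ω be the form and p ω = ∑ q_j ω x_j. Deleting a last x_b gives -p x_{b*} = q_b ω. Deleting
x_b once more kills the left side, as b* ≠ b, and turns the right side into -q_b x_{b*}. So q_b = 0,
and then p = 0. -/
theorem W_eq_bot (m : ℕ) (hm : 3 ≤ m) : W 2 (D.relLine 0 0) m = ⊥ := by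
  rw [eq_bot_iff]
  intro w hw
  simp only [W, Submodule.mem_iInf, Submodule.mem_comap] at hw
  have h0 := hw (m - 2) 0 (by omega)
  have h1 := hw (m - 3) 1 (by omega)
  obtain ⟨p, hp⟩ : ∃ p, TensorPower.toTensorAlgebra w = p * D.form := by
    have hle : tpow k (Fin n → k) (m - 2) * D.relLine 0 0 * tpow k (Fin n → k) 0 ≤
        LinearMap.range (LinearMap.mulRight k D.form) := by
      rw [tpow, tpow, pow_zero, mul_one, D.relLine_zero]
      refine Submodule.mul_le.mpr fun a _ b hb => ?_
      obtain ⟨c, rfl⟩ := Submodule.mem_span_singleton.mp hb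
      exact ⟨c • a, by simp⟩
    obtain ⟨p, hp⟩ := hle h0
    exact ⟨p, hp.symm⟩
  obtain ⟨q, hq⟩ : ∃ q : Fin n → TensorAlgebra k (Fin n → k),
      TensorPower.toTensorAlgebra w = ∑ j, q j * D.form * gen k j := by
    have hle : tpow k (Fin n → k) (m - 3) * D.relLine 0 0 * tpow k (Fin n → k) 1 ≤
        LinearMap.range (∑ j, LinearMap.mulRight k (D.form * gen k j) ∘ₗ LinearMap.proj j :
          (Fin n → TensorAlgebra k (Fin n → k)) →ₗ[k] TensorAlgebra k (Fin n → k)) := by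
      rw [tpow, tpow, pow_one, D.relLine_zero]
      refine Submodule.mul_le.mpr fun t ht u hu => ?_
      refine Submodule.mul_induction_on ht (fun a _ b hb => ?_) fun x y hx hy => ?_
      · obtain ⟨c, rfl⟩ := Submodule.mem_span_singleton.mp hb
        obtain ⟨e, rfl⟩ := hu
        refine ⟨fun j => (c * e j) • a, ?_⟩
        rw [ι_eq_sum, Finset.mul_sum, LinearMap.sum_apply]
        refine Finset.sum_congr rfl fun j _ => ?_
        simp [smul_smul, mul_assoc, mul_comm]
      · rw [add_mul]; exact Submodule.add_mem _ hx hy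
    obtain ⟨q, hq⟩ := hle h1
    exact ⟨q, by rw [← hq]; simp [mul_assoc]⟩
  have e1 : q D.base * D.form = -(p * gen k (D.star D.base)) := by
    have h := congrArg (rightDeriv D.base) (hp.symm.trans hq)
    rw [mul_rightDeriv, D.sgn_base, one_smul, map_sum] at h
    simpa [rightDeriv_mul_gen] using h.symm
  have e2 : q D.base = 0 := by
    have h := congrArg (rightDeriv D.base) e1
    rw [mul_rightDeriv, D.sgn_base, one_smul, map_neg, rightDeriv_mul_gen,
      if_neg (D.star_ne _), neg_inj] at h
    exact eq_zero_of_mul_gen_eq_zero h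
  rw [e2, zero_mul, eq_comm, neg_eq_zero] at e1
  rw [eq_zero_of_mul_gen_eq_zero e1, zero_mul] at hp
  exact (Submodule.mem_bot k).mpr (toTensorAlgebra_injective m (by rw [hp, map_zero]))

/-- The generator `x_j`, as an element of `V^{⊗ 1}`. -/
def powGen (k : Type u) [Field k] {n : ℕ} (j : Fin n) : ⨂[k]^1 (Fin n → k) :=
  PiTensorProduct.tprod k fun _ => Pi.single j 1

theorem toTensorAlgebra_powGen (j : Fin n) :
    TensorPower.toTensorAlgebra (powGen k j) = gen k j := by
  simp [powGen, gen, TensorPower.toTensorAlgebra_tprod]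

theorem toTensorAlgebra_mulEquiv {V : Type u} [AddCommGroup V] [Module k V] {i j : ℕ}
    (a : ⨂[k]^i V) (b : ⨂[k]^j V) :
    TensorPower.toTensorAlgebra (TensorPower.mulEquiv (a ⊗ₜ b)) =
      TensorPower.toTensorAlgebra a * TensorPower.toTensorAlgebra b := by
  rw [← TensorPower.toTensorAlgebra_gMul]
  rfl

/-- The quadratic form, as an element of `V^{⊗ 2}`. -/
def powForm : ⨂[k]^(1 + 1) (Fin n → k) :=
  ∑ j, D.sgn j • TensorPower.mulEquiv (powGen k j ⊗ₜ powGen k (D.star j))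

theorem toTensorAlgebra_powForm : TensorPower.toTensorAlgebra (powForm D) = D.form := by
  simp only [powForm, map_sum, map_smul, toTensorAlgebra_mulEquiv, toTensorAlgebra_powGen,
    Darboux.form]

theorem W_two : W 2 (D.relLine 0 0) (1 + 1) = Submodule.span k {powForm D} := by
  have h0 : tpow k (Fin n → k) 0 * D.relLine 0 0 * tpow k (Fin n → k) 0 = D.relLine 0 0 := by
    rw [tpow, pow_zero, one_mul, mul_one]
  refine le_antisymm (fun w hw => ?_) ?_
  · simp only [W, Submodule.mem_iInf, Submodule.mem_comap] at hw
    have h := hw 0 0 rfl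
    rw [h0, D.relLine_zero] at h
    obtain ⟨c, hc⟩ := Submodule.mem_span_singleton.mp h
    refine Submodule.mem_span_singleton.mpr ⟨c, toTensorAlgebra_injective _ ?_⟩
    rw [map_smul, toTensorAlgebra_powForm, hc]
  · rw [Submodule.span_singleton_le_iff_mem]
    simp only [W, Submodule.mem_iInf, Submodule.mem_comap]
    intro i j hij
    obtain rfl : i = 0 := by omega
    obtain rfl : j = 0 := by omega
    rw [h0, toTensorAlgebra_powForm, D.relLine_zero]
    exact Submodule.mem_span_singleton_self _

/-- The intersection is over an empty family of pairs i, j. -/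
theorem W_one : W 2 (D.relLine 0 0) (1 + 0) = ⊤ := by
  rw [eq_top_iff]
  intro w _
  simp only [W, Submodule.mem_iInf]
  intro i j hij
  omega

/-- The coordinates on `V^{⊗ 1}`. -/
noncomputable def powCoord (j : Fin n) : (⨂[k]^1 (Fin n → k)) →ₗ[k] k :=
  LinearMap.proj j ∘ₗ (PiTensorProduct.subsingletonEquiv (R := k) (0 : Fin 1)).toLinearMap

theorem powCoord_powGen (i j : Fin n) : powCoord j (powGen k i) = if j = i then 1 else 0 := by
  simp [powCoord, powGen, Pi.single_apply]

theorem sum_powCoord (w : ⨂[k]^1 (Fin n → k)) : ∑ j, powCoord j w • powGen k j = w := by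
  apply (PiTensorProduct.subsingletonEquiv (R := k) (0 : Fin 1)).injective
  ext i
  simp [powCoord, powGen, Pi.single_apply]

theorem exists_eq_sum_tmul {A : Type*} [AddCommGroup A] [Module k A]
    (z : A ⊗[k] (⨂[k]^1 (Fin n → k))) : ∃ a : Fin n → A, z = ∑ j, a j ⊗ₜ powGen k j := by
  induction z using TensorProduct.induction_on with
  | zero => exact ⟨0, by simp⟩
  | tmul a w =>
    refine ⟨fun j => powCoord j w • a, ?_⟩
    conv_lhs => rw [← sum_powCoord w, TensorProduct.tmul_sum]
    simp only [TensorProduct.tmul_smul, TensorProduct.smul_tmul']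
  | add y z hy hz =>
    obtain ⟨a, rfl⟩ := hy
    obtain ⟨b, rfl⟩ := hz
    exact ⟨a + b, by simp [TensorProduct.add_tmul, Finset.sum_add_distrib]⟩

theorem eq_zero_of_sum_tmul {A : Type*} [AddCommGroup A] [Module k A] {a : Fin n → A}
    (h : ∑ j, a j ⊗ₜ[k] powGen k j = 0) (j : Fin n) : a j = 0 := by
  have h1 := congrArg (fun z => TensorProduct.rid k A (LinearMap.lTensor A (powCoord j) z)) h
  simpa [powCoord_powGen] using h1

theorem eq_zero_of_tmul_one {A V : Type u} [AddCommGroup A] [Module k A] [AddCommGroup V]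
    [Module k V] {a : A}
    (h : a ⊗ₜ[k] (PiTensorProduct.tprod k (Fin.elim0 : Fin 0 → V)) = 0) : a = 0 := by
  have h1 := congrArg (fun z => TensorProduct.rid k A (LinearMap.lTensor A
    (TensorPower.algebraMap₀ (R := k) (M := V)).symm.toLinearMap z)) h
  have h2 : (TensorPower.algebraMap₀ (R := k) (M := V)).symm
      (PiTensorProduct.tprod k (Fin.elim0 : Fin 0 → V)) = 1 := by
    rw [LinearEquiv.symm_apply_eq, TensorPower.algebraMap₀_one]
    rfl
  simpa [h2] using h1

variable {D}

/-- Exactness of the Koszul complex in degree one, in terms of the algebra. -/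
theorem Presents.exists_eq_mul_of_sum_mul_eq_zero {A : Type u} [Ring A] [Algebra k A]
    {y : Fin n → A} (hy : Presents D 0 0 y) {a : Fin n → A} (h : ∑ j, a j * y j = 0) :
    ∃ b, ∀ j, a j = (-D.sgn j) • (b * y (D.star j)) := by
  let c : Fin n → A := fun j => (-D.sgn j) • y (D.star j)
  let N : Submodule A (Fin n → A) := Submodule.span A {c}
  let q : Fin n → (Fin n → A) ⧸ N := fun j => N.mkQ (Pi.single j 1)
  have hq : ∀ f : Fin n → A, N.mkQ f = ∑ j, f j • q j := by
    intro f
    simp only [q, ← map_smul, ← map_sum]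
    congr 1
    ext i
    simp [Finset.sum_apply, Pi.single_apply]
  have hq0 : ∑ j, c j • q j = 0 := by
    rw [← hq]
    exact (Submodule.Quotient.mk_eq_zero N).mpr (Submodule.mem_span_singleton_self _)
  obtain ⟨χ, hχ⟩ := hy.lift k (fun _ => 0) (by simp [SatisfiesRel])
  -- With the augmentation χ on the right, Δ(a y_j) = a q_j. Thus Δ carries ∑ a_j y_j to the class
  -- of (a_j) modulo the line over A spanned by c.
  obtain ⟨Δ, -, hΔ, hm⟩ := hy.exists_derivation (Algebra.lsmul k k ((Fin n → A) ⧸ N))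
    ((Algebra.lsmul k k k).comp χ) (fun j => LinearMap.toSpanSingleton k _ (q j)) (by
      intro s
      have h1 : ∑ j, D.sgn j • s • y j • q (D.star j) = s • ∑ j, c j • q j := by
        rw [← D.sum_star, Finset.smul_sum]
        refine Finset.sum_congr rfl fun j _ => ?_
        rw [D.star_star, D.sgn_star, smul_assoc, smul_comm]
      rw [hq0, smul_zero] at h1
      simpa [hχ, smul_comm _ s] using h1)
  have h0 : N.mkQ a = 0 := by
    have := congrArg (fun t => Δ t 1) h
    simpa [hm, hχ, hΔ, hq] using this
  obtain ⟨b, hb⟩ := Submodule.mem_span_singleton.mp ((Submodule.Quotient.mk_eq_zero N).mp h0)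
  exact ⟨b, fun j => by rw [← hb]; simp [c]⟩

variable (D)

theorem qmk_toTensorAlgebra_powGen (j : Fin n) :
    qmk (D.relLine 0 0) (TensorPower.toTensorAlgebra (powGen k j)) =
      quotGen (D.relLine 0 0) j := by
  rw [toTensorAlgebra_powGen]; rfl

theorem splitMul_powForm (a : QuotAlg (D.relLine 0 0)) :
    splitMul (D.relLine 0 0) 1 1 (a ⊗ₜ powForm D) =
      ∑ j, ((-D.sgn j) • (a * quotGen (D.relLine 0 0) (D.star j))) ⊗ₜ powGen k j := by
  rw [powForm, TensorProduct.tmul_sum, map_sum, ← D.sum_star]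
  refine Finset.sum_congr rfl fun j _ => ?_
  rw [D.star_star, D.sgn_star, TensorProduct.tmul_smul, map_smul, splitMul_tmul,
    qmk_toTensorAlgebra_powGen, TensorProduct.smul_tmul']

theorem splitMul_powGen (a : QuotAlg (D.relLine 0 0)) (j : Fin n) :
    splitMul (D.relLine 0 0) 1 0 (a ⊗ₜ powGen k j) =
      (a * quotGen (D.relLine 0 0) j) ⊗ₜ PiTensorProduct.tprod k (Fin.elim0 : Fin 0 → Fin n → k) := by
  have h : (powGen k j : ⨂[k]^(1 + 0) (Fin n → k)) = TensorPower.mulEquiv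
      (powGen k j ⊗ₜ PiTensorProduct.tprod k (Fin.elim0 : Fin 0 → Fin n → k)) := by
    refine toTensorAlgebra_injective (1 + 0) ?_
    rw [toTensorAlgebra_mulEquiv, TensorPower.toTensorAlgebra_tprod]
    simp
  rw [← qmk_toTensorAlgebra_powGen, ← splitMul_tmul, ← h]

theorem exists_of_mem_range_W_two {z : QuotAlg (D.relLine 0 0) ⊗[k] (⨂[k]^(1 + 1) (Fin n → k))}
    (hz : z ∈ LinearMap.range
      (LinearMap.lTensor (QuotAlg (D.relLine 0 0)) (W 2 (D.relLine 0 0) (1 + 1)).subtype)) :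
    ∃ a, z = a ⊗ₜ powForm D := by
  obtain ⟨z, rfl⟩ := hz
  induction z using TensorProduct.induction_on with
  | zero => exact ⟨0, by simp⟩
  | tmul a w =>
    obtain ⟨c, hc⟩ := Submodule.mem_span_singleton.mp ((W_two D).le w.2)
    refine ⟨c • a, ?_⟩
    rw [LinearMap.lTensor_tmul, Submodule.subtype_apply, ← hc, TensorProduct.tmul_smul,
      TensorProduct.smul_tmul']
  | add y z hy hz =>
    obtain ⟨a, ha⟩ := hy
    obtain ⟨b, hb⟩ := hz
    exact ⟨a + b, by rw [map_add, ha, hb, TensorProduct.add_tmul]⟩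

theorem range_lTensor_W_eq_bot (m : ℕ) (hm : 3 ≤ m) :
    LinearMap.range (LinearMap.lTensor (QuotAlg (D.relLine 0 0))
      (W 2 (D.relLine 0 0) m).subtype) = ⊥ := by
  have : (W 2 (D.relLine 0 0) m).subtype = 0 := by
    rw [W_eq_bot D m hm]
    exact Subsingleton.elim _ _
  rw [this, LinearMap.lTensor_zero, LinearMap.range_zero]

/-- The complex is 0 → A ⊗ kω → A ⊗ V → A with ω the form. Injectivity on the left holds because the
coordinate of the image at b* is a x_b, and x_b can be cancelled; exactness at A ⊗ V is
`Presents.exists_eq_mul_of_sum_mul_eq_zero`. -/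
theorem koszulComplex_exact (c : ℕ) :
    LinearMap.range (LinearMap.lTensor (QuotAlg (D.relLine 0 0))
        (W 2 (D.relLine 0 0) (1 + c)).subtype) ⊓
      LinearMap.ker (splitMul (D.relLine 0 0) 1 c) =
    (LinearMap.range (LinearMap.lTensor (QuotAlg (D.relLine 0 0))
        (W 2 (D.relLine 0 0) (1 + (1 + c))).subtype)).map (splitMul (D.relLine 0 0) 1 (1 + c)) := by
  have hy := presents_quotGen D 0 0
  match c with
  | c + 2 =>
    rw [range_lTensor_W_eq_bot D _ (by omega), range_lTensor_W_eq_bot D _ (by omega),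
      Submodule.map_bot, bot_inf_eq]
  | 1 =>
    rw [range_lTensor_W_eq_bot D (1 + (1 + 1)) (by omega), Submodule.map_bot, eq_bot_iff]
    rintro z ⟨hz, hz'⟩
    obtain ⟨a, rfl⟩ := exists_of_mem_range_W_two D hz
    rw [SetLike.mem_coe, LinearMap.mem_ker, splitMul_powForm] at hz'
    have h := eq_zero_of_sum_tmul hz' (D.star D.base)
    rw [D.star_star, D.sgn_star, D.sgn_base, neg_neg, one_smul] at h
    rw [hy.mul_base_injective h, TensorProduct.zero_tmul]
    exact Submodule.zero_mem _
  | 0 =>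
    apply le_antisymm
    · rintro z ⟨-, hz⟩
      obtain ⟨a, rfl⟩ := exists_eq_sum_tmul (n := n) z
      rw [SetLike.mem_coe, LinearMap.mem_ker, map_sum] at hz
      simp only [splitMul_powGen, ← TensorProduct.sum_tmul] at hz
      obtain ⟨b, hb⟩ := hy.exists_eq_mul_of_sum_mul_eq_zero (eq_zero_of_tmul_one hz)
      refine ⟨b ⊗ₜ powForm D, ⟨b ⊗ₜ ⟨powForm D, ?_⟩, rfl⟩, ?_⟩
      · exact (W_two D).symm ▸ Submodule.mem_span_singleton_self _
      · refine (splitMul_powForm D b).trans ?_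
        simp only [hb]
    · rintro _ ⟨z, hz, rfl⟩
      obtain ⟨a, rfl⟩ := exists_of_mem_range_W_two D hz
      refine ⟨?_, ?_⟩
      · have hs : Function.Surjective (W 2 (D.relLine 0 0) (1 + 0)).subtype :=
          fun w => ⟨⟨w, (W_one D).ge Submodule.mem_top⟩, rfl⟩
        exact LinearMap.lTensor_surjective _ hs _
      · rw [SetLike.mem_coe, LinearMap.mem_ker]
        refine (congrArg _ (splitMul_powForm D a)).trans ?_
        rw [map_sum]
        simp only [splitMul_powGen, ← TensorProduct.sum_tmul]
        have h := hy.rel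
        rw [SatisfiesRel, ← D.sum_star] at h
        simp only [D.star_star, D.sgn_star, Pi.zero_apply, zero_smul, Finset.sum_const_zero,
          map_zero, add_zero] at h
        have h2 : ∑ j, (-D.sgn j) • (a * quotGen (D.relLine 0 0) (D.star j)) *
            quotGen (D.relLine 0 0) j = 0 := by
          rw [← mul_zero a, ← h, Finset.mul_sum]
          simp only [smul_mul_assoc, mul_smul_comm, mul_assoc]
        rw [h2, TensorProduct.zero_tmul]

theorem nuStep_two (i : ℕ) : nuStep 2 i = 1 := by
  rw [nuStep]; split_ifs <;> rfl

theorem Darboux.isNKoszul : IsNKoszul 2 (D.relLine 0 0) := by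
  refine ⟨le_rfl, D.relLine_zero_le_tpow, fun i => ?_⟩
  -- The step lengths of ν_2 occur in the types, so they are generalised to variables before being
  -- replaced by 1.
  have h : ∀ a b c : ℕ, a = 1 → b = 1 →
      LinearMap.range (LinearMap.lTensor (QuotAlg (D.relLine 0 0))
          (W 2 (D.relLine 0 0) (a + c)).subtype) ⊓
        LinearMap.ker (splitMul (D.relLine 0 0) a c) =
      (LinearMap.range (LinearMap.lTensor (QuotAlg (D.relLine 0 0))
          (W 2 (D.relLine 0 0) (b + (a + c))).subtype)).map
            (splitMul (D.relLine 0 0) b (a + c)) := by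
    rintro _ _ c rfl rfl
    exact koszulComplex_exact D c
  exact h _ _ _ (nuStep_two i) (nuStep_two (i + 1))

theorem Darboux.isKoszulFiltered (v : Fin n → k) (l : k) :
    IsKoszulFiltered (D.relLine v l) := by
  refine ⟨2, le_rfl, D.relLine_le_tfilt v l, ?_⟩
  rw [D.map_tproj_relLine]
  exact ⟨D.isNKoszul, D.isPBWDeformation v l⟩

end KoszulComplex

/-! ### The standard symplectic pairing -/

section Standard

variable (k : Type u) [Field k] {n : ℕ}

/-- The standard pairing `i ↔ i + n / 2`. -/
def standardDarboux (hn : Even n) (hn2 : 2 ≤ n) : Darboux k n where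
  star j := if h : j.1 < n / 2 then ⟨j + n / 2, by omega⟩ else ⟨j - n / 2, by omega⟩
  sgn j := if j.1 < n / 2 then 1 else -1
  base := ⟨0, by omega⟩
  star_star j := by
    obtain ⟨m, rfl⟩ := hn
    ext
    by_cases h : j.1 < (m + m) / 2
    · simp [h]
    · have h' : j.1 - (m + m) / 2 < (m + m) / 2 := by omega
      simp [h, h']
      omega
  sgn_star j := by
    obtain ⟨m, rfl⟩ := hn
    by_cases h : j.1 < (m + m) / 2
    · simp [h]
    · have h' : j.1 - (m + m) / 2 < (m + m) / 2 := by omega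
      simp [h, h']
  sgn_mul_self j := by split_ifs <;> simp
  sgn_base := by
    have : 0 < n / 2 := by omega
    simp [this]
  star_ne j := by
    intro e
    have := congrArg Fin.val e
    split_ifs at this <;> simp at this <;> omega

/-- Each commutator contributes the two terms of opposite sign indexed by i and i + n/2. -/
theorem symplecticForm_eq (hn : Even n) (hn2 : 2 ≤ n) :
    symplecticForm k n = (standardDarboux k hn hn2).form := by
  obtain ⟨m, rfl⟩ := hn
  have hm : (m + m) / 2 = m := by omega
  have h1 : symplecticForm k (m + m) = ∑ i : Fin m,
      ⁅gen k (Fin.castAdd m i), gen k (Fin.natAdd m i)⁆ := by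
    rw [symplecticForm]
    refine Fintype.sum_equiv (finCongr hm) _ _ fun i => ?_
    congr 2
    ext
    simp [hm, add_comm]
  rw [h1, Darboux.form, Fin.sum_univ_add, ← Finset.sum_add_distrib]
  refine Finset.sum_congr rfl fun i _ => ?_
  have s1 : (standardDarboux k ⟨m, rfl⟩ hn2).star (Fin.castAdd m i) = Fin.natAdd m i := by
    ext; simp [standardDarboux, hm, add_comm]
  have s2 : (standardDarboux k ⟨m, rfl⟩ hn2).star (Fin.natAdd m i) = Fin.castAdd m i := by
    ext; simp [standardDarboux, hm]
  have t1 : (standardDarboux k ⟨m, rfl⟩ hn2).sgn (Fin.castAdd m i) = 1 := by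
    simp [standardDarboux, hm]
  have t2 : (standardDarboux k ⟨m, rfl⟩ hn2).sgn (Fin.natAdd m i) = -1 := by
    simp [standardDarboux, hm]
  rw [s1, s2, t1, t2, one_smul, neg_smul, one_smul, Ring.lie_def, sub_eq_add_neg]

theorem relSpace_eq (hn : Even n) (hn2 : 2 ≤ n) (v : Fin n → k) (l : k) :
    relSpace n v l = (standardDarboux k hn hn2).relLine v l := by
  rw [relSpace, Darboux.relLine, symplecticForm_eq k hn hn2]

end Standard

end KoszulPBW

theorem mainTheorem3 {k : Type u} [Field k] (n : ℕ) (hn : Even n) (hn2 : 2 ≤ n)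
    (v : Fin n → k) (l : k) :
    KoszulPBW.IsKoszulFiltered (KoszulPBW.relSpace n v l) ∧
    (∀ i : ℕ, i ≠ 2 →
      Subsingleton (KoszulPBW.HH k (KoszulPBW.QuotAlg (KoszulPBW.relSpace n v l))
        (KoszulPBW.outerBimod k (KoszulPBW.QuotAlg (KoszulPBW.relSpace n v l))) i)) ∧
    (KoszulPBW.IsCalabiYau k (KoszulPBW.QuotAlg (KoszulPBW.relSpace n v l)) 2 ↔ v = 0) := by
  rw [KoszulPBW.relSpace_eq k hn hn2]
  have hx := KoszulPBW.presents_quotGen (KoszulPBW.standardDarboux k hn hn2) v l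
  refine ⟨KoszulPBW.Darboux.isKoszulFiltered _ v l, hx.subsingleton_ext,
    hx.eq_zero_of_isCalabiYau, ?_⟩
  rintro rfl
  exact hx.isCalabiYau_of_eq_zero
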